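/- Let $\mathbb T^2=\mathbb R^2/\mathbb Z^2$, and let $F$ be the Green's function of the torus, that is, $F$ solves $\Delta F=2\pi(\delta_0-1)$ in the sense of distributions on $\mathbb T^2$ (and is understood as the representative that is a classical function away from $0$), normalized by $\lim_{x\to0}(F(x)-\log|x|)=0$. Let $a_1,\dots,a_m\in\mathbb T^2$ be distinct points, let $d_1,\dots,d_m$ be integers with $\sum_j d_j=0$, and put $\Phi(x)=\sum_{j=1}^m d_jF(x-a_j)$. For a scalar function $f$ write $\nabla\times f=(f_{x_2},-f_{x_1})$; for $u$ with values in $\mathbb R^2\cong\mathbb C$ write $j^k(u)=u\times u_{x_k}=u^1u^2_{x_k}-u^2u^1_{x_k}$, $k=1,2$; let $\mathbb J=\begin{pmatrix}0&1\\-1&0\end{pmatrix}$, and sum over repeated indices. A canonical harmonic map with singularities of degrees $d_1,\dots,d_m$ at $a_1,\dots,a_m$ is a map $H\in C^\infty_{\mathrm{loc}}(\mathbb T^2\setminus\{a_1,\dots,a_m\};S^1)\cap W^{1,1}(\mathbb T^2;S^1)$ with $j(H)=-\nabla\times\Phi$ on $\mathbb T^2\setminus\{a_1,\dots,a_m\}$.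 Lemma. Suppose that $\eta\in C^2(\mathbb T^2)$ is real-valued and, for some $i$, $\operatorname{supp}(\eta)\cap\{a_1,\dots,a_m\}=\{a_i\}$ and $D^2\eta\equiv0$ in a neighborhood of $a_i$. If $H$ is a canonical harmonic map with singularities of degrees $d_1,\dots,d_m$ at $a_1,\dots,a_m$, then the following integrand is integrable and $$\int_{\mathbb T^2}\eta_{x_jx_l}\,\mathbb J_{jk}\,j^k(H)\,j^l(H)\,dx=d_i\,D\eta(a_i)\cdot\Big(2\pi\sum_{j\ne i}d_j\,\nabla\times F(a_i-a_j)\Big).$$ The same holds, whether or not such a map $H$ exists for the given points and degrees, with $j(H)$ replaced by the vector field $-\nabla\times\Phi$. -/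

import Mathlib

open scoped ContDiff Topology
open MeasureTheory Filter

noncomputable section

namespace TorusVortex

/-- The flat unit torus `ℝ² / ℤ²`; `volume` on it is Haar measure of total mass one. -/
abbrev T2 : Type := UnitAddTorus (Fin 2)

/-- The covering map `ℝ² → ℝ² / ℤ²`. -/
def proj (y : EuclideanSpace ℝ (Fin 2)) : T2 := fun k => ((y k : ℝ) : UnitAddCircle)

/-- `C^n` functions on the torus: the periodic lift to the plane is `C^n`. -/
def TorusContDiff (n : ℕ∞) {E : Type*} [NormedAddCommGroup E] [NormedSpace ℝ E]
    (f : T2 → E) : Prop :=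
  ContDiff ℝ n (fun y => f (proj y))

/-- `C^n` functions on a subset of the torus (used for open subsets). -/
def TorusContDiffOn (n : ℕ∞) {E : Type*} [NormedAddCommGroup E] [NormedSpace ℝ E]
    (f : T2 → E) (U : Set T2) : Prop :=
  ContDiffOn ℝ n (fun y => f (proj y)) (proj ⁻¹' U)

/-- The partial derivative `f_{x_k}` of a function on the torus. -/
def pd {E : Type*} [NormedAddCommGroup E] [NormedSpace ℝ E]
    (k : Fin 2) (f : T2 → E) (x : T2) : E :=
  deriv (fun t : ℝ => f (x + Pi.single k (t : UnitAddCircle))) 0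

/-- The Laplacian on the torus. -/
def lap (f : T2 → ℝ) (x : T2) : ℝ := ∑ k, pd k (pd k f) x

/-- The gradient `D f = (f_{x_1}, f_{x_2})`. -/
def grad (f : T2 → ℝ) (x : T2) : Fin 2 → ℝ := fun k => pd k f x

/-- The curl of a scalar function, `∇ × f = (f_{x_2}, - f_{x_1})`. -/
def curl (f : T2 → ℝ) (x : T2) : Fin 2 → ℝ := ![pd 1 f x, - pd 0 f x]

/-- The matrix `𝕁`. -/
def J : Matrix (Fin 2) (Fin 2) ℝ := !![0, 1; -1, 0]

/-- The cross product `u × v = u¹ v² - u² v¹` on `ℝ² = ℂ`. -/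
def cross (u v : ℂ) : ℝ := u.re * v.im - u.im * v.re

/-- The current `j(u) = (u × u_{x_1}, u × u_{x_2})`. -/
def current (u : T2 → ℂ) (x : T2) : Fin 2 → ℝ := fun k => cross (u x) (pd k u x)

/-- `g` is the weak partial derivative of `f` in direction `k`. -/
def HasWeakPd (k : Fin 2) (f g : T2 → ℂ) : Prop :=
  ∀ φ : T2 → ℝ, TorusContDiff ⊤ φ → ∫ x, pd k φ x • f x = - ∫ x, φ x • g x

/-- The Sobolev space `W^{1,1}` of the torus. -/
def MemW11 (f : T2 → ℂ) : Prop :=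
  Integrable f ∧ ∀ k, ∃ g : T2 → ℂ, Integrable g ∧ HasWeakPd k f g

/-- `F` is the Green's function of the torus: `Δ F = 2π (δ₀ - 1)` in the sense of distributions,
normalized by `F(x) - log |x| → 0` as `x → 0`. Pointwise, `F` is the representative which is a
classical function away from the pole. -/
structure IsGreen (F : T2 → ℝ) : Prop where
  contDiffOn : TorusContDiffOn 2 F {0}ᶜ
  integrable : Integrable F
  laplacian : ∀ φ : T2 → ℝ, TorusContDiff ⊤ φ →
    ∫ x, F x * lap φ x = 2 * Real.pi * (φ 0 - ∫ x, φ x)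
  normalized : Tendsto (fun y : EuclideanSpace ℝ (Fin 2) => F (proj y) - Real.log ‖y‖)
    (𝓝[≠] 0) (𝓝 0)

/-- The potential `Φ(x) = ∑ i, d_i F(x - a_i)`. -/
def potential (F : T2 → ℝ) {m : ℕ} (a : Fin m → T2) (d : Fin m → ℤ) (x : T2) : ℝ :=
  ∑ i, (d i : ℝ) * F (x - a i)

/-- `H` is a canonical harmonic map with singularities of degrees `d` at the points `a`:
a map into the unit circle, smooth away from the points `a`, in `W^{1,1}`, and satisfying
`j(H) = - ∇ × Φ`. -/
structure IsCanonicalHarmonicMap (F : T2 → ℝ) {m : ℕ} (a : Fin m → T2) (d : Fin m → ℤ)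
    (H : T2 → ℂ) : Prop where
  norm_eq_one : ∀ x ∉ Set.range a, ‖H x‖ = 1
  contDiffOn : TorusContDiffOn ⊤ H (Set.range a)ᶜ
  memW11 : MemW11 H
  current_eq : ∀ x ∉ Set.range a, current H x = - curl (potential F a d) x

/-- The integrand `η_{x_j x_l} 𝕁_{jk} v^k v^l`, summed over repeated indices. -/
def integrand (η : T2 → ℝ) (v : T2 → Fin 2 → ℝ) (x : T2) : ℝ :=
  ∑ j, ∑ k, ∑ l, pd l (pd j η) x * J j k * v x k * v x l

end TorusVortex

end

open TorusVortex

/-! Identify the plane with `ℂ` and put f = Φ_x - iΦ_y (`tgrad`) and ∂̄ = ∂_x + i∂_y (`dbar`). Since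
ΔF = -2π away from the pole and the degrees sum to zero, Φ is harmonic off the vortices, so ∂̄f = 0
there. For v = -∇×Φ the integrand is pointwise ½ Im(∂̄P · f²) with P = ∂̄η (`integrand_eq_im`), so
everything reduces to integrating ∂̄P · f².

By the hypotheses on η, P is constant near a_i and zero near the other vortices. Subtract P(a_i)χ,
where χ is a radial cutoff at a_i: what remains vanishes near every vortex, so its ∂̄ integrates to
zero against f² (`integral_dbar_mul_tgrad_sq`). There is left P(a_i) ∫ ∂̄χ · f², a residue
computation in polar coordinates: if f = d_i/z + Q near a_i with Q holomorphic, it equals -4π d_i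
Q(0) P(a_i) (`integral_cutoff_sq_simplePole`).

It remains to find Q(0) (`exists_simplePole`). Removing d_i log|z| from Φ leaves a harmonic function
with a limit at a_i, and a gradient estimate makes the singularity of its complex derivative
removable. The Green's function is even, by the maximum principle (`IsGreen.even`), so the gradient
of F - log|z| is odd and contributes nothing to Q(0). Only the terms j ≠ i survive.

A canonical harmonic map enters only through its current, which equals -∇×Φ off a finite, hence
null, set. -/

noncomputable section

namespace TorusVortex

/-! ### The covering map and lifts to the complex plane -/

/-- The covering map of the torus, with the plane viewed as `ℂ`. -/
def cproj (z : ℂ) : T2 := fun k => ((![z.re, z.im] k : ℝ) : UnitAddCircle)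

/-- The lift of `f` to the plane, with base point `x`. -/
def lift {E : Type*} (x : T2) (f : T2 → E) (z : ℂ) : E := f (x + cproj z)

/-- The coordinate directions in `ℂ`. -/
def dir (k : Fin 2) : ℂ := ![1, Complex.I] k

lemma cproj_add (z w : ℂ) : cproj (z + w) = cproj z + cproj w := by
  ext k; fin_cases k <;> simp [cproj]

@[simp] lemma cproj_zero : cproj 0 = 0 := by
  ext k; fin_cases k <;> simp [cproj]

lemma cproj_neg (z : ℂ) : cproj (-z) = -cproj z := by
  ext k; fin_cases k <;> simp [cproj]

lemma cproj_smul_dir (k : Fin 2) (t : ℝ) :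
    cproj ((t : ℂ) * dir k) = Pi.single k (t : UnitAddCircle) := by
  ext j; fin_cases k <;> fin_cases j <;> simp [cproj, dir]

lemma proj_eq_cproj (y : EuclideanSpace ℝ (Fin 2)) :
    proj y = cproj (Complex.orthonormalBasisOneI.repr.symm y) := by
  ext k; fin_cases k <;> simp [cproj, proj, Complex.orthonormalBasisOneI_repr_symm_apply]

lemma cproj_eq_proj (z : ℂ) : cproj z = proj (Complex.orthonormalBasisOneI.repr z) := by
  simp [proj_eq_cproj]

lemma continuous_cproj : Continuous cproj := by
  refine continuous_pi fun k => ?_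
  refine (AddCircle.continuous_mk' 1).comp ?_
  fin_cases k
  · exact Complex.continuous_re
  · exact Complex.continuous_im

lemma isOpenMap_cproj : IsOpenMap cproj := by
  have h : cproj = (Pi.map fun _ : Fin 2 => ((↑) : ℝ → UnitAddCircle)) ∘
      Complex.equivRealProdCLM.toHomeomorph.trans (Homeomorph.finTwoArrow (X := ℝ)).symm := by
    ext z k; fin_cases k <;> rfl
  rw [h]
  exact (IsOpenMap.piMap (fun _ => QuotientAddGroup.isOpenMap_coe) (by simp)).comp
    (Homeomorph.isOpenMap _)

lemma cproj_surjective : Function.Surjective cproj := by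
  intro x
  obtain ⟨s, hs⟩ := QuotientAddGroup.mk_surjective (x 0)
  obtain ⟨t, ht⟩ := QuotientAddGroup.mk_surjective (x 1)
  refine ⟨⟨s, t⟩, ?_⟩
  ext k; fin_cases k
  · exact hs
  · exact ht

/-- The covering is both continuous and open, so germs transfer in both directions between the torus
and the plane. -/
lemma map_nhds_cproj (x : T2) (w : ℂ) :
    map (fun z => x + cproj z) (𝓝 w) = 𝓝 (x + cproj w) := by
  refine IsOpenMap.map_nhds_eq ?_ ?_
  · exact (isOpenMap_add_left x).comp isOpenMap_cproj
  · exact (continuous_const.add continuous_cproj).continuousAt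

lemma tendsto_cproj (x : T2) (w : ℂ) :
    Tendsto (fun z => x + cproj z) (𝓝 w) (𝓝 (x + cproj w)) := (map_nhds_cproj x w).le

section Lift

variable {E : Type*} {x : T2} {f : T2 → E}

lemma lift_zero : lift x f 0 = f x := by simp [lift]

lemma lift_add (z w : ℂ) : lift (x + cproj w) f z = lift x f (z + w) := by
  simp only [lift, cproj_add]; congr 1; abel

lemma exists_add_cproj (x y : T2) : ∃ z, y = x + cproj z := by
  obtain ⟨z, hz⟩ := cproj_surjective (y - x)
  exact ⟨z, by simp [hz]⟩

end Lift

/-! ### Pointwise smoothness and calculus of partial derivatives on the torus -/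

section Smooth

variable {E : Type*} [NormedAddCommGroup E] [NormedSpace ℝ E]

/-- Pointwise `C^n` regularity of a function on the torus. -/
def SmoothAt (n : WithTop ℕ∞) (f : T2 → E) (x : T2) : Prop := ContDiffAt ℝ n (lift x f) 0

variable {n : WithTop ℕ∞} {f g : T2 → E} {x : T2}

lemma smoothAt_add_cproj (w : ℂ) :
    SmoothAt n f (x + cproj w) ↔ ContDiffAt ℝ n (lift x f) w := by
  have h : lift (x + cproj w) f = fun z => lift x f (z + w) := by
    ext z; exact lift_add z w
  have h' : lift x f = fun z => (fun z => lift x f (z + w)) (z - w) := by ext z; simp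
  unfold SmoothAt
  rw [h]
  constructor
  · intro hf
    rw [h']
    refine ContDiffAt.comp w (g := fun z => lift x f (z + w)) (f := fun z => z - w) ?_ (by fun_prop)
    simpa using hf
  · intro hf
    refine ContDiffAt.comp (0 : ℂ) (g := lift x f) (f := fun z => z + w) ?_ (by fun_prop)
    simpa using hf

lemma TorusContDiff.smoothAt {n : ℕ∞} (h : TorusContDiff n f) (x : T2) : SmoothAt n f x := by
  obtain ⟨w, rfl⟩ := exists_add_cproj 0 x
  rw [smoothAt_add_cproj]
  have : lift 0 f = (fun y => f (proj y)) ∘ Complex.orthonormalBasisOneI.repr := by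
    ext z; simp [lift, cproj_eq_proj]
  rw [this]
  exact (ContDiff.comp h (LinearIsometryEquiv.contDiff _)).contDiffAt

lemma torusContDiff_of_smoothAt {n : ℕ∞} (h : ∀ x, SmoothAt n f x) : TorusContDiff n f := by
  have : (fun y => f (proj y)) = lift 0 f ∘ Complex.orthonormalBasisOneI.repr.symm := by
    ext z; simp [lift, proj_eq_cproj]
  unfold TorusContDiff
  rw [this]
  refine ContDiff.comp (contDiff_iff_contDiffAt.2 fun w => ?_) (LinearIsometryEquiv.contDiff _)
  exact (smoothAt_add_cproj w).1 (h _)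

lemma TorusContDiffOn.smoothAt {n : ℕ∞} {U : Set T2} (h : TorusContDiffOn n f U) (hU : U ∈ 𝓝 x) :
    SmoothAt n f x := by
  obtain ⟨w, rfl⟩ := exists_add_cproj 0 x
  rw [smoothAt_add_cproj]
  have : lift 0 f = (fun y => f (proj y)) ∘ Complex.orthonormalBasisOneI.repr := by
    ext z; simp [lift, cproj_eq_proj]
  rw [this]
  refine ContDiffAt.comp w (ContDiffOn.contDiffAt h ?_)
    (LinearIsometryEquiv.contDiff _).contDiffAt
  have hc : Continuous proj := by
    have : proj = cproj ∘ Complex.orthonormalBasisOneI.repr.symm := by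
      ext1 y; exact proj_eq_cproj y
    rw [this]; exact continuous_cproj.comp (LinearIsometryEquiv.continuous _)
  refine hc.continuousAt.preimage_mem_nhds ?_
  simpa [← cproj_eq_proj] using hU

lemma lift_eventuallyEq {E : Type*} {f g : T2 → E} {x : T2} (h : f =ᶠ[𝓝 x] g) :
    lift x f =ᶠ[𝓝 0] lift x g := by
  have := tendsto_cproj x 0
  rw [cproj_zero, add_zero] at this
  exact this.eventually h

lemma SmoothAt.congr (hf : SmoothAt n f x) (h : g =ᶠ[𝓝 x] f) : SmoothAt n g x :=
  ContDiffAt.congr_of_eventuallyEq hf (lift_eventuallyEq h)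

lemma smoothAt_const (c : E) : SmoothAt n (fun _ => c) x := contDiffAt_const

lemma SmoothAt.of_le {m : WithTop ℕ∞} (hf : SmoothAt n f x) (h : m ≤ n) : SmoothAt m f x :=
  ContDiffAt.of_le hf h

lemma SmoothAt.add (hf : SmoothAt n f x) (hg : SmoothAt n g x) :
    SmoothAt n (fun y => f y + g y) x := ContDiffAt.add hf hg

lemma SmoothAt.sub (hf : SmoothAt n f x) (hg : SmoothAt n g x) :
    SmoothAt n (fun y => f y - g y) x := ContDiffAt.sub hf hg

lemma SmoothAt.mul {A : Type*} [NormedRing A] [NormedAlgebra ℝ A] {f g : T2 → A}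
    (hf : SmoothAt n f x) (hg : SmoothAt n g x) :
    SmoothAt n (fun y => f y * g y) x := ContDiffAt.mul hf hg

lemma SmoothAt.sum {ι : Type*} {s : Finset ι} {f : ι → T2 → E}
    (hf : ∀ i ∈ s, SmoothAt n (f i) x) : SmoothAt n (fun y => ∑ i ∈ s, f i y) x :=
  ContDiffAt.sum (f := fun i => lift x (f i)) hf

lemma SmoothAt.ofReal {f : T2 → ℝ} (hf : SmoothAt n f x) :
    SmoothAt n (fun y => (f y : ℂ)) x :=
  Complex.ofRealCLM.contDiff.contDiffAt.comp (0 : ℂ) hf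

lemma continuousAt_of_lift {E : Type*} [TopologicalSpace E] {f : T2 → E} {x : T2}
    (h : ContinuousAt (lift x f) 0) : ContinuousAt f x := by
  have h2 := map_nhds_cproj x 0
  rw [cproj_zero, add_zero] at h2
  rw [ContinuousAt, ← h2, tendsto_map'_iff]
  rw [ContinuousAt, lift_zero] at h
  exact h

lemma SmoothAt.continuousAt (hf : SmoothAt n f x) : ContinuousAt f x :=
  continuousAt_of_lift (ContDiffAt.continuousAt hf)

lemma SmoothAt.sub_const {c : T2} (hf : SmoothAt n f (x - c)) :
    SmoothAt n (fun y => f (y - c)) x := by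
  have : lift x (fun y => f (y - c)) = lift (x - c) f := by
    ext z; simp only [lift]; congr 1; abel
  unfold SmoothAt
  rw [this]; exact hf

lemma SmoothAt.comp_neg (hf : SmoothAt n f (-x)) :
    SmoothAt n (fun y => f (-y)) x := by
  have : lift x (fun y => f (-y)) = fun z => lift (-x) f (-z) := by
    ext z; simp only [lift, cproj_neg]; congr 1; abel
  unfold SmoothAt
  rw [this]
  refine ContDiffAt.comp (0 : ℂ) (g := lift (-x) f) (f := fun z => -z) ?_ (by fun_prop)
  rw [neg_zero]; exact hf

lemma pd_add_cproj (k : Fin 2) (f : T2 → E) (x : T2) (w : ℂ) :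
    pd k f (x + cproj w) = deriv (fun t : ℝ => lift x f (w + t * dir k)) 0 := by
  simp only [pd, lift, cproj_add, cproj_smul_dir, add_assoc]

lemma hasDerivAt_line {F : ℂ → E} {w : ℂ} (h : DifferentiableAt ℝ F w) (k : Fin 2) :
    HasDerivAt (fun t : ℝ => F (w + t * dir k)) (fderiv ℝ F w (dir k)) 0 := by
  have h1 : HasDerivAt (fun t : ℝ => w + t * dir k) (dir k) 0 := by
    have := ((Complex.ofRealCLM.hasDerivAt (x := (0:ℝ))).mul_const (dir k)).const_add w
    simpa using this
  have h2 : HasFDerivAt F (fderiv ℝ F w) (w + ((0:ℝ):ℂ) * dir k) := by simpa using h.hasFDerivAt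
  exact h2.comp_hasDerivAt (0:ℝ) h1

lemma pd_eq_fderiv {w : ℂ} (k : Fin 2) (h : DifferentiableAt ℝ (lift x f) w) :
    pd k f (x + cproj w) = fderiv ℝ (lift x f) w (dir k) := by
  rw [pd_add_cproj, (hasDerivAt_line h k).deriv]

lemma SmoothAt.differentiableAt (h : SmoothAt n f x) (hn : n ≠ 0) :
    DifferentiableAt ℝ (lift x f) 0 := ContDiffAt.differentiableAt h hn

lemma SmoothAt.hasDerivAt (h : SmoothAt n f x) (hn : n ≠ 0) (k : Fin 2) :
    HasDerivAt (fun t : ℝ => f (x + Pi.single k (t : UnitAddCircle))) (pd k f x) 0 := by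
  have h1 := hasDerivAt_line (h.differentiableAt hn) k
  have h2 := pd_eq_fderiv (x := x) (w := 0) k (h.differentiableAt hn)
  rw [cproj_zero, add_zero] at h2
  rw [← h2] at h1
  simpa [lift, cproj_smul_dir] using h1

/-- Near `x`, the lift of `pd k f` is a directional derivative of the lift of `f`. -/
lemma SmoothAt.lift_pd (h : SmoothAt 1 f x) (k : Fin 2) :
    lift x (pd k f) =ᶠ[𝓝 0] fun w => fderiv ℝ (lift x f) w (dir k) := by
  filter_upwards [ContDiffAt.eventually h (by simp)] with w hw
  exact pd_eq_fderiv k (hw.differentiableAt (by simp))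

lemma SmoothAt.pd {m : WithTop ℕ∞} (h : SmoothAt n f x) (hm : m + 1 ≤ n) (k : Fin 2) :
    SmoothAt m (pd k f) x := by
  have h1 : SmoothAt 1 f x := h.of_le (le_trans le_add_self hm)
  refine ContDiffAt.congr_of_eventuallyEq ?_ (h1.lift_pd k)
  exact (ContDiffAt.fderiv_right (m := m) h hm).clm_apply contDiffAt_const

lemma pd_congr (k : Fin 2) (h : f =ᶠ[𝓝 x] g) : pd k f x = pd k g x := by
  refine EventuallyEq.deriv_eq ?_
  have : Tendsto (fun t : ℝ => x + Pi.single k (t : UnitAddCircle)) (𝓝 0) (𝓝 x) := by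
    have h1 : Tendsto (fun t : ℝ => (t : ℂ) * dir k) (𝓝 0) (𝓝 0) := by
      have : Continuous (fun t : ℝ => (t : ℂ) * dir k) := by fun_prop
      simpa using this.tendsto 0
    have h2 := (tendsto_cproj x 0).comp h1
    simpa [Function.comp_def, cproj_smul_dir] using h2
  exact this.eventually h

lemma pd_eventuallyEq (k : Fin 2) (h : f =ᶠ[𝓝 x] g) : TorusVortex.pd k f =ᶠ[𝓝 x] pd k g := by
  filter_upwards [h.eventuallyEq_nhds] with y hy using pd_congr k hy

@[simp] lemma pd_const (k : Fin 2) (c : E) : pd k (fun _ : T2 => c) x = 0 := by simp [TorusVortex.pd]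

lemma pd_eq_zero (k : Fin 2) {c : E} (h : f =ᶠ[𝓝 x] fun _ => c) : pd k f x = 0 := by
  rw [pd_congr k h, pd_const]

lemma pd_add (hf : SmoothAt 1 f x) (hg : SmoothAt 1 g x) (k : Fin 2) :
    pd k (fun y => f y + g y) x = pd k f x + pd k g x :=
  ((hf.hasDerivAt one_ne_zero k).add (hg.hasDerivAt one_ne_zero k)).deriv

lemma pd_sub (hf : SmoothAt 1 f x) (hg : SmoothAt 1 g x) (k : Fin 2) :
    pd k (fun y => f y - g y) x = pd k f x - pd k g x :=
  ((hf.hasDerivAt one_ne_zero k).sub (hg.hasDerivAt one_ne_zero k)).deriv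

lemma pd_sum {ι : Type*} {s : Finset ι} {f : ι → T2 → E}
    (hf : ∀ i ∈ s, SmoothAt 1 (f i) x) (k : Fin 2) :
    pd k (fun y => ∑ i ∈ s, f i y) x = ∑ i ∈ s, pd k (f i) x :=
  (HasDerivAt.fun_sum fun i hi => (hf i hi).hasDerivAt one_ne_zero k).deriv

lemma pd_mul {A : Type*} [NormedRing A] [NormedAlgebra ℝ A] {f g : T2 → A}
    (hf : SmoothAt 1 f x) (hg : SmoothAt 1 g x) (k : Fin 2) :
    pd k (fun y => f y * g y) x = pd k f x * g x + f x * pd k g x := by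
  have := ((hf.hasDerivAt one_ne_zero k).mul (hg.hasDerivAt one_ne_zero k)).deriv
  simp only [AddCircle.coe_zero, Pi.single_zero, add_zero] at this
  exact this

lemma pd_ofReal {f : T2 → ℝ} (hf : SmoothAt 1 f x) (k : Fin 2) :
    pd k (fun y => (f y : ℂ)) x = ((pd k f x : ℝ) : ℂ) :=
  (hf.hasDerivAt one_ne_zero k).ofReal_comp.deriv

lemma pd_const_mul {A : Type*} [NormedRing A] [NormedAlgebra ℝ A] (c : A) {f : T2 → A}
    (hf : SmoothAt 1 f x) (k : Fin 2) :
    pd k (fun y => c * f y) x = c * pd k f x :=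
  ((hf.hasDerivAt one_ne_zero k).const_mul c).deriv

lemma pd_comp_sub (k : Fin 2) (f : T2 → E) (c x : T2) :
    pd k (fun y => f (y - c)) x = pd k f (x - c) := by
  simp only [TorusVortex.pd]; congr 1; ext t; congr 1; abel

lemma pd_comp_neg (k : Fin 2) (f : T2 → E) (x : T2) :
    pd k (fun y => f (-y)) x = - pd k f (-x) := by
  have h : (fun t : ℝ => f (-(x + Pi.single k (t : UnitAddCircle)))) =
      fun t : ℝ => (fun t : ℝ => f (-x + Pi.single k (t : UnitAddCircle))) (-t) := by
    ext t
    simp only [AddCircle.coe_neg, Pi.single_neg]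
    congr 1; abel
  simp only [TorusVortex.pd]
  rw [h]
  have := deriv_comp_neg (fun t : ℝ => f (-x + Pi.single k (t : UnitAddCircle))) 0
  rwa [neg_zero] at this

end Smooth

/-! ### Harmonic functions and contour integrals in one complex variable -/

section

open InnerProductSpace Metric

section Complex

/-- The complex derivative `u_x - i u_y`. -/
def cgrad (u : ℂ → ℝ) (z : ℂ) : ℂ :=
  (fderiv ℝ u z 1 : ℂ) - Complex.I * (fderiv ℝ u z Complex.I : ℂ)

lemma cgrad_congr {u v : ℂ → ℝ} {z : ℂ} (h : u =ᶠ[𝓝 z] v) : cgrad u z = cgrad v z := by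
  simp only [cgrad, h.fderiv_eq]

/-- This is the Cauchy–Riemann equations: G' = u_x - iu_y for u = Re G. -/
lemma cgrad_eq_deriv {u : ℂ → ℝ} {G : ℂ → ℂ} {z : ℂ} (hG : DifferentiableAt ℂ G z)
    (h : u =ᶠ[𝓝 z] fun w => (G w).re) : cgrad u z = deriv G z := by
  have h1 : HasFDerivAt (fun w => (G w).re)
      (Complex.reCLM.comp ((fderiv ℂ G z).restrictScalars ℝ)) z :=
    Complex.reCLM.hasFDerivAt.comp z (hG.hasFDerivAt.restrictScalars ℝ)
  have h2 : fderiv ℂ G z Complex.I = Complex.I * deriv G z := by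
    rw [fderiv_eq_smul_deriv, smul_eq_mul]
  rw [cgrad_congr h, cgrad, h1.fderiv]
  simp only [ContinuousLinearMap.coe_comp, Function.comp_apply,
    ContinuousLinearMap.coe_restrictScalars', Complex.reCLM_apply, h2, fderiv_apply_one_eq_deriv]
  apply Complex.ext <;> simp

/-- With u = Re G, the function exp(G/ε) has modulus between 1/e and e. Cauchy's estimate on the
circle of radius R bounds its derivative by e/R, and dividing by the lower bound 1/e produces the
factor e². The exponential avoids any control of Im G. -/
lemma norm_cgrad_le {u : ℂ → ℝ} {z : ℂ} {R ε : ℝ} (hR : 0 < R) (hε : 0 < ε)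
    (hu : HarmonicOnNhd u (ball z (2 * R))) (hb : ∀ w ∈ ball z (2 * R), |u w| ≤ ε) :
    ‖cgrad u z‖ ≤ Real.exp 2 * ε / R := by
  obtain ⟨G, hG, hGu⟩ := hu.exists_analyticOnNhd_ball_re_eq
  have hz : z ∈ ball z (2 * R) := mem_ball_self (by linarith)
  have hsub : closedBall z R ⊆ ball z (2 * R) := closedBall_subset_ball (by linarith)
  rw [cgrad_eq_deriv (hG z hz).differentiableAt
    (by filter_upwards [isOpen_ball.mem_nhds hz] with w hw using (hGu hw).symm)]
  have hexp : ∀ w ∈ ball z (2 * R), ‖Complex.exp (G w / ε)‖ ≤ Real.exp 1 ∧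
      Real.exp (-1) ≤ ‖Complex.exp (G w / ε)‖ := by
    intro w hw
    have h1 : (G w).re = u w := hGu hw
    have h2 := abs_le.1 (hb w hw)
    rw [Complex.norm_exp, Complex.div_ofReal_re, h1, Real.exp_le_exp, Real.exp_le_exp,
      div_le_iff₀ hε, le_div_iff₀ hε]
    constructor <;> linarith
  have hd : DifferentiableOn ℂ (fun w => Complex.exp (G w / ε)) (ball z (2 * R)) := fun w hw =>
    (((hG w hw).differentiableAt.div_const _).cexp).differentiableWithinAt
  have hle := Complex.norm_deriv_le_of_forall_mem_sphere_norm_le hR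
    (DifferentiableOn.diffContOnCl (hd.mono (closure_ball_subset_closedBall.trans hsub)))
    (fun w hw => (hexp w (hsub (sphere_subset_closedBall hw))).1)
  rw [(((hG z hz).differentiableAt.hasDerivAt.div_const (ε : ℂ)).cexp).deriv, norm_mul,
    norm_div, Complex.norm_real, Real.norm_of_nonneg hε.le] at hle
  have h3 := (hexp z hz).2
  have h4 : Real.exp (-1) * (‖deriv G z‖ / ε) ≤ Real.exp 1 / R :=
    (mul_le_mul_of_nonneg_right h3 (by positivity)).trans hle
  have h5 : Real.exp 1 * Real.exp (-1) = 1 := by rw [← Real.exp_add]; simp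
  have h6 : Real.exp 2 = Real.exp 1 * Real.exp 1 := by rw [← Real.exp_add]; norm_num
  have h7 : ‖deriv G z‖ / ε ≤ Real.exp 2 / R := by
    calc ‖deriv G z‖ / ε = Real.exp 1 * (Real.exp (-1) * (‖deriv G z‖ / ε)) := by
          rw [← mul_assoc, h5, one_mul]
      _ ≤ Real.exp 1 * (Real.exp 1 / R) := by gcongr
      _ = Real.exp 2 / R := by rw [h6]; ring
  rw [div_le_iff₀ hε] at h7
  calc ‖deriv G z‖ ≤ Real.exp 2 / R * ε := h7
    _ = _ := by ring

/-- The derivative of a harmonic function on a punctured disc which has a limit at the centre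
extends holomorphically. -/
lemma exists_holomorphic_extension_cgrad {h : ℂ → ℝ} {r L : ℝ} (hr : 0 < r)
    (hh : HarmonicOnNhd h (ball 0 r \ {0})) (hL : Tendsto h (𝓝[≠] 0) (𝓝 L)) :
    ∃ Q : ℂ → ℂ, DifferentiableOn ℂ Q (ball 0 r) ∧ ∀ z ∈ ball (0 : ℂ) r, z ≠ 0 →
      Q z = cgrad h z := by
  have hs : ball (0 : ℂ) r ∈ 𝓝 (0 : ℂ) := ball_mem_nhds _ hr
  have hd : DifferentiableOn ℂ (cgrad h) (ball 0 r \ {0}) := fun z hz =>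
    (HarmonicAt.differentiableAt_complex_partial (hh z hz)).differentiableWithinAt
  have ho : (cgrad h) =o[𝓝[≠] 0] fun z => z⁻¹ := by
    rw [Asymptotics.isLittleO_iff]
    intro c hc
    -- The gradient estimate is used on the disc of radius |z| about z, that is with R = |z|/2. It
    -- gives 2e²ε/|z| = c/(2|z|), within the required c/|z|.
    set ε := c / (4 * Real.exp 2) with hε
    have hε0 : 0 < ε := by positivity
    have h1 : ∀ᶠ z in 𝓝[≠] (0 : ℂ), |h z - L| ≤ ε := by
      filter_upwards [hL (closedBall_mem_nhds L hε0)] with z hz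
      simpa [Real.dist_eq] using hz
    rw [eventually_nhdsWithin_iff, Metric.eventually_nhds_iff_ball] at h1
    obtain ⟨δ, hδ, h1⟩ := h1
    have h2 : ∀ᶠ z in 𝓝 (0 : ℂ), ‖z‖ < min δ r / 2 := by
      filter_upwards [ball_mem_nhds (0 : ℂ) (show 0 < min δ r / 2 by positivity)] with z hz
      simpa using hz
    rw [eventually_nhdsWithin_iff]
    filter_upwards [h2] with z hz hz0
    have hz0' : 0 < ‖z‖ := norm_pos_iff.2 hz0
    have hsub : ∀ w ∈ ball z (2 * (‖z‖ / 2)), ‖w‖ < min δ r ∧ w ≠ 0 := by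
      intro w hw
      rw [mem_ball, dist_eq_norm] at hw
      have e1 : ‖w‖ ≤ ‖w - z‖ + ‖z‖ := by simpa using norm_add_le (w - z) z
      refine ⟨by linarith, ?_⟩
      rintro rfl
      rw [zero_sub, norm_neg] at hw
      linarith
    have hmin1 := min_le_left δ r
    have hmin2 := min_le_right δ r
    have hharm : HarmonicOnNhd (fun w => h w - L) (ball z (2 * (‖z‖ / 2))) := by
      refine HarmonicOnNhd.sub (fun w hw => hh w ?_) (harmonicOnNhd_const L)
      have := hsub w hw
      simpa using ⟨by linarith, this.2⟩
    have key := norm_cgrad_le (half_pos hz0') hε0 hharm (fun w hw => h1 w (by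
      have := hsub w hw
      simpa using by linarith) (hsub w hw).2)
    have e : cgrad (fun w => h w - L) z = cgrad h z := by simp only [cgrad, fderiv_sub_const]
    rw [e] at key
    refine key.trans ?_
    rw [norm_inv, hε]
    have := Real.exp_pos 2
    rw [← div_eq_mul_inv, div_le_div_iff₀ (by positivity) hz0']
    have e2 : Real.exp 2 * (c / (4 * Real.exp 2)) = c / 4 := by field_simp
    rw [e2]; nlinarith
  -- The removable singularity theorem is stated for the difference from the value at the centre;
  -- that value is a constant, hence also o(1/z).
  have ho' : (fun z => cgrad h z - cgrad h 0) =o[𝓝[≠] 0] fun z => (z - 0)⁻¹ := by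
    simp only [sub_zero]
    refine ho.sub ?_
    refine Asymptotics.isLittleO_const_left.2 (Or.inr ?_)
    simpa [Function.comp_def] using tendsto_norm_inv_nhdsNE_zero_atTop (α := ℂ)
  refine ⟨_, Complex.differentiableOn_update_limUnder_of_isLittleO hs hd ho', ?_⟩
  intro z _ hz
  rw [Function.update_of_ne hz]

/-- Locally log|w| is the real part of log(cw) - log c. One of c = 1, c = -1 keeps cz off the branch
cut. -/
lemma cgrad_log_norm {z : ℂ} (hz : z ≠ 0) : cgrad (fun w => Real.log ‖w‖) z = z⁻¹ := by
  have key : ∀ c : ℂ, c ≠ 0 → c * z ∈ Complex.slitPlane →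
      cgrad (fun w => Real.log ‖w‖) z = z⁻¹ := by
    intro c hc hcz
    have hd : HasDerivAt (fun w => Complex.log (c * w) - Complex.log c) (c / (c * z)) z := by
      have := ((hasDerivAt_id z).const_mul c).clog hcz
      simpa using this.sub_const (Complex.log c)
    rw [cgrad_eq_deriv hd.differentiableAt, hd.deriv]
    · field_simp
    · filter_upwards [isOpen_ne.mem_nhds hz] with w hw
      simp only [Complex.sub_re, Complex.log_re, norm_mul]
      rw [Real.log_mul (by simpa using hc) (by simpa using hw)]
      ring
  rcases Complex.mem_slitPlane_or_neg_mem_slitPlane hz with h | h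
  · exact key 1 one_ne_zero (by simpa using h)
  · exact key (-1) (by simp) (by simpa using h)

/-- On expanding the square, the double pole c²/z² has no residue and Q² is holomorphic; only the
cross term 2cQ/z contributes. -/
lemma circleIntegral_sq_simplePole {Q : ℂ → ℂ} {r ρ : ℝ} (hQ : DifferentiableOn ℂ Q (ball 0 r))
    (hρ : 0 < ρ) (hρr : ρ < r) (c : ℂ) :
    (∮ z in C(0, ρ), (c * z⁻¹ + Q z) ^ 2) = 4 * Real.pi * Complex.I * c * Q 0 := by
  have hsub : closedBall (0 : ℂ) ρ ⊆ ball 0 r := closedBall_subset_ball hρr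
  have hQc : ContinuousOn Q (sphere 0 ρ) :=
    (hQ.continuousOn).mono (sphere_subset_closedBall.trans hsub)
  have hinv : ContinuousOn (fun z : ℂ => z⁻¹) (sphere 0 ρ) := by
    refine continuousOn_id.inv₀ fun z hz => ?_
    rintro rfl
    simp at hz; exact hρ.ne hz
  have hball : ∀ x ∈ ball (0 : ℂ) ρ \ ∅, DifferentiableAt ℂ Q x := fun x hx =>
    hQ.differentiableAt (isOpen_ball.mem_nhds (ball_subset_ball hρr.le hx.1))
  have i1 : (∮ z in C(0, ρ), c ^ 2 * (z - 0) ^ (-2 : ℤ)) = 0 := by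
    rw [circleIntegral.integral_const_mul,
      circleIntegral.integral_sub_zpow_of_ne (by norm_num), mul_zero]
  have i2 : (∮ z in C(0, ρ), 2 * c * ((z - 0)⁻¹ • Q z)) = 2 * c * (2 * Real.pi * Complex.I * Q 0) := by
    rw [circleIntegral.integral_const_mul,
      Complex.circleIntegral_sub_inv_smul_of_differentiable_on_off_countable
      (Set.countable_empty) (mem_ball_self hρ) (hQ.continuousOn.mono hsub) hball, smul_eq_mul]
  have i3 : (∮ z in C(0, ρ), Q z ^ 2) = 0 :=
    Complex.circleIntegral_eq_zero_of_differentiable_on_off_countable hρ.le Set.countable_empty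
      ((hQ.continuousOn.mono hsub).pow 2) (fun x hx => (hball x hx).pow 2)
  have c1 : CircleIntegrable (fun z : ℂ => c ^ 2 * (z - 0) ^ (-2 : ℤ)) 0 ρ := by
    refine ContinuousOn.circleIntegrable hρ.le ?_
    refine ((continuousOn_const (c := c ^ 2)).mul (hinv.pow 2)).congr fun z _ => ?_
    simp [zpow_neg]
  have c2 : CircleIntegrable (fun z : ℂ => 2 * c * ((z - 0)⁻¹ • Q z)) 0 ρ := by
    refine ContinuousOn.circleIntegrable hρ.le ?_
    simp only [sub_zero]
    exact continuousOn_const.mul (hinv.smul hQc)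
  have c3 : CircleIntegrable (fun z : ℂ => Q z ^ 2) 0 ρ :=
    ContinuousOn.circleIntegrable hρ.le (hQc.pow 2)
  have e : ∀ z ∈ sphere (0 : ℂ) ρ, (c * z⁻¹ + Q z) ^ 2 =
      (c ^ 2 * (z - 0) ^ (-2 : ℤ) + 2 * c * ((z - 0)⁻¹ • Q z)) + Q z ^ 2 := by
    intro z _
    simp only [sub_zero, zpow_neg, smul_eq_mul]
    norm_cast
    ring
  rw [circleIntegral.integral_congr hρ.le e, circleIntegral.integral_add (f := fun z : ℂ => _ + _) (c1.add c2) c3,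
    circleIntegral.integral_add c1 c2, i1, i2, i3]
  ring

/-- This is the contour integral rewritten with dz = iz dθ, shifted by periodicity to the angular
range of polar coordinates. -/
lemma integral_polar_sq_simplePole {Q : ℂ → ℂ} {r ρ : ℝ} (hQ : DifferentiableOn ℂ Q (ball 0 r))
    (hρ : 0 < ρ) (hρr : ρ < r) (c : ℂ) :
    ∫ θ in Set.Ioo (-Real.pi) Real.pi, circleMap 0 ρ θ *
      (c * (circleMap 0 ρ θ)⁻¹ + Q (circleMap 0 ρ θ)) ^ 2 = 4 * Real.pi * c * Q 0 := by
  have h := circleIntegral_sq_simplePole hQ hρ hρr c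
  rw [circleIntegral] at h
  set g : ℝ → ℂ := fun θ => circleMap 0 ρ θ *
      (c * (circleMap 0 ρ θ)⁻¹ + Q (circleMap 0 ρ θ)) ^ 2 with hg
  have hper : Function.Periodic g (2 * Real.pi) := fun θ => by
    simp only [hg, periodic_circleMap 0 ρ θ]
  have e : (∫ θ in (0 : ℝ)..2 * Real.pi, Complex.I * g θ) = 4 * Real.pi * Complex.I * c * Q 0 := by
    rw [← h]
    refine intervalIntegral.integral_congr fun θ _ => ?_
    simp only [hg, deriv_circleMap, smul_eq_mul]
    ring
  rw [intervalIntegral.integral_const_mul] at e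
  have e2 : (∫ θ in (0 : ℝ)..2 * Real.pi, g θ) = 4 * Real.pi * c * Q 0 :=
    mul_left_cancel₀ Complex.I_ne_zero (by rw [e]; ring)
  rw [← integral_Ioc_eq_integral_Ioo, ← intervalIntegral.integral_of_le (by linarith [Real.pi_pos]),
    ← e2]
  have := hper.intervalIntegral_add_eq (-Real.pi) 0
  rw [zero_add, show -Real.pi + 2 * Real.pi = Real.pi by ring] at this
  exact this

/-- If u = Re G then |exp G| = exp u, so the maximum modulus principle for exp G applies. -/
lemma eventually_eq_of_isLocalMax_harmonic {u : ℂ → ℝ} {z : ℂ} (hu : HarmonicAt u z)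
    (hm : IsLocalMax u z) : ∀ᶠ w in 𝓝 z, u w = u z := by
  obtain ⟨R, hR, hR'⟩ := Metric.eventually_nhds_iff_ball.1 hu.eventually
  obtain ⟨G, hG, hGu⟩ := InnerProductSpace.HarmonicOnNhd.exists_analyticOnNhd_ball_re_eq (f := u)
    (z := z) (R := R) hR'
  have hn : ∀ w ∈ ball z R, ‖Complex.exp (G w)‖ = Real.exp (u w) := fun w hw => by
    rw [Complex.norm_exp]; exact congrArg _ (hGu hw)
  have hz := mem_ball_self (x := z) hR
  have h := Complex.eventually_eq_of_isLocalMax_norm (f := fun w => Complex.exp (G w)) (c := z)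
    (by filter_upwards [isOpen_ball.mem_nhds hz] with w hw using (hG w hw).differentiableAt.cexp)
    (by
      filter_upwards [isOpen_ball.mem_nhds hz, hm] with w hw hw'
      simp only [Function.comp_apply, hn w hw, hn z hz]
      exact Real.exp_le_exp.2 hw')
  filter_upwards [h, isOpen_ball.mem_nhds hz] with w hw hwb
  have := congrArg norm hw
  rwa [hn w hwb, hn z hz, Real.exp_eq_exp] at this

end Complex

end

/-! ### Radial cutoffs in the plane and the residue integral -/

section

open Metric

/-- A radial profile, equal to `1` for `t` near `0` and to `0` for large `t`. -/
def radialProfile (K t : ℝ) : ℝ := Real.smoothTransition (2 - K * t)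

lemma contDiff_radialProfile (K : ℝ) {n : ℕ∞} : ContDiff ℝ n (radialProfile K) :=
  Real.smoothTransition.contDiff.comp (by fun_prop)

lemma radialProfile_eq_one {K t : ℝ} (h : K * t ≤ 1) : radialProfile K t = 1 :=
  Real.smoothTransition.one_of_one_le (by linarith)

lemma radialProfile_eq_zero {K t : ℝ} (h : 2 ≤ K * t) : radialProfile K t = 0 :=
  Real.smoothTransition.zero_of_nonpos (by linarith)

lemma deriv_radialProfile_eq_zero {K t : ℝ} (h : K * t < 1 ∨ 2 < K * t) :
    deriv (radialProfile K) t = 0 := by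
  have hc : Continuous fun s : ℝ => K * s := by fun_prop
  rcases h with h | h
  · have : radialProfile K =ᶠ[𝓝 t] fun _ => 1 := by
      filter_upwards [(isOpen_Iio.preimage hc).mem_nhds h] with s hs
      exact radialProfile_eq_one (le_of_lt hs)
    rw [this.deriv_eq, deriv_const]
  · have : radialProfile K =ᶠ[𝓝 t] fun _ => 0 := by
      filter_upwards [(isOpen_Ioi.preimage hc).mem_nhds h] with s hs
      exact radialProfile_eq_zero (le_of_lt hs)
    rw [this.deriv_eq, deriv_const]

lemma continuous_deriv_radialProfile (K : ℝ) : Continuous (deriv (radialProfile K)) :=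
  (contDiff_radialProfile K (n := 1)).continuous_deriv (by simp)

/-- The integrand is the derivative of ρ ↦ `radialProfile K (ρ ^ 2)`, which falls from 1 to 0. -/
lemma integral_radialProfile {K r : ℝ} (hr : 0 < r) (hK : 2 < K * r ^ 2) :
    ∫ ρ in Set.Ioi (0 : ℝ), deriv (radialProfile K) (ρ ^ 2) * (2 * ρ) = -1 := by
  have hK0 : 0 < K := by
    by_contra! h
    nlinarith [sq_nonneg r]
  have hd : ∀ ρ : ℝ, HasDerivAt (fun ρ => radialProfile K (ρ ^ 2))
      (deriv (radialProfile K) (ρ ^ 2) * (2 * ρ)) ρ := fun ρ => by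
    have h1 := ((contDiff_radialProfile K (n := 1)).differentiable (by simp) (ρ ^ 2)).hasDerivAt
    have h2 : HasDerivAt (fun ρ : ℝ => ρ ^ 2) (2 * ρ) ρ := by simpa using hasDerivAt_pow 2 ρ
    exact HasDerivAt.comp (h := fun ρ : ℝ => ρ ^ 2) ρ h1 h2
  have hlarge : ∀ ρ : ℝ, r ≤ ρ → 2 < K * ρ ^ 2 := fun ρ hρ =>
    hK.trans_le (by gcongr)
  have hc : Continuous fun ρ : ℝ => deriv (radialProfile K) (ρ ^ 2) * (2 * ρ) :=
    ((continuous_deriv_radialProfile K).comp (by fun_prop)).mul (by fun_prop)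
  have hint : IntegrableOn (fun ρ : ℝ => deriv (radialProfile K) (ρ ^ 2) * (2 * ρ))
      (Set.Ioi 0) := by
    refine IntegrableOn.of_forall_sdiff_eq_zero (s := Set.Icc 0 r)
      (hc.continuousOn.integrableOn_compact isCompact_Icc) measurableSet_Ioi ?_
    intro ρ hρ
    have : r ≤ ρ := by
      by_contra! h
      exact hρ.2 ⟨le_of_lt hρ.1, h.le⟩
    rw [deriv_radialProfile_eq_zero (Or.inr (hlarge ρ this)), zero_mul]
  have hlim : Tendsto (fun ρ => radialProfile K (ρ ^ 2)) atTop (𝓝 0) := by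
    refine tendsto_const_nhds.congr' ?_
    filter_upwards [eventually_ge_atTop r] with ρ hρ
    exact (radialProfile_eq_zero (hlarge ρ hρ).le).symm
  rw [integral_Ioi_of_hasDerivAt_of_tendsto (hd 0).continuousAt.continuousWithinAt
    (fun ρ _ => hd ρ) hint hlim, radialProfile_eq_one (by simp)]
  norm_num

/-- Pairing of the square of a function with a simple pole against `∂̄` of a radial cutoff. -/
lemma integral_cutoff_sq_simplePole {f Q : ℂ → ℂ} {r K : ℝ} (c : ℂ) (hr : 0 < r)
    (hK : 2 < K * r ^ 2)
    (hQ : DifferentiableOn ℂ Q (ball 0 r))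
    (hf : ∀ z ∈ ball (0 : ℂ) r, z ≠ 0 → f z = c * z⁻¹ + Q z) :
    ∫ z : ℂ, ((deriv (radialProfile K) (‖z‖ ^ 2) : ℝ) : ℂ) * (2 * z) * f z ^ 2 =
      -(4 * Real.pi * c * Q 0) := by
  have hK0 : 0 < K := by
    by_contra! h
    nlinarith [sq_nonneg r]
  have hlarge : ∀ ρ : ℝ, r ≤ ρ → 2 < K * ρ ^ 2 := fun ρ hρ =>
    hK.trans_le (by gcongr)
  set g : ℂ → ℂ := fun z => ((deriv (radialProfile K) (‖z‖ ^ 2) : ℝ) : ℂ) * (2 * z) * f z ^ 2 with hg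
  have hzero : ∀ z : ℂ, (K * ‖z‖ ^ 2 < 1 ∨ 2 < K * ‖z‖ ^ 2) → g z = 0 := fun z hz => by
    simp [hg, deriv_radialProfile_eq_zero hz]
  have hfc : ∀ z ∈ ball (0 : ℂ) r, z ≠ 0 → ContinuousAt f z := by
    intro z hz hz0
    have h1 : ContinuousAt (fun z => c * z⁻¹ + Q z) z :=
      (continuousAt_const.mul (continuousAt_inv₀ hz0)).add
        (hQ.differentiableAt (isOpen_ball.mem_nhds hz)).continuousAt
    refine h1.congr ?_
    filter_upwards [isOpen_ball.mem_nhds hz, isOpen_ne.mem_nhds hz0] with w hw hw0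
    exact (hf w hw hw0).symm
  have hcn : Continuous fun z : ℂ => K * ‖z‖ ^ 2 := by fun_prop
  -- The derivative of the profile vanishes near the pole and outside the disc, the only places
  -- where f is not known to be continuous.
  have hgc : Continuous g := by
    rw [continuous_iff_continuousAt]
    intro z
    by_cases hz0 : z = 0
    · have : g =ᶠ[𝓝 z] fun _ => 0 := by
        filter_upwards [(isOpen_Iio.preimage hcn).mem_nhds
          (show z ∈ (fun z : ℂ => K * ‖z‖ ^ 2) ⁻¹' Set.Iio 1 by simp [hz0])] with w hw
        exact hzero w (Or.inl hw)
      exact continuousAt_const.congr this.symm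
    by_cases hz : z ∈ ball (0 : ℂ) r
    · refine ((Complex.continuous_ofReal.continuousAt.comp ?_).mul (by fun_prop)).mul
        ((hfc z hz hz0).pow 2)
      exact ((continuous_deriv_radialProfile K).comp (by fun_prop)).continuousAt
    · have : g =ᶠ[𝓝 z] fun _ => 0 := by
        filter_upwards [(isOpen_Ioi.preimage hcn).mem_nhds
          (show z ∈ (fun z : ℂ => K * ‖z‖ ^ 2) ⁻¹' Set.Ioi 2 from
            hlarge _ (by simpa using hz))] with w hw
        exact hzero w (Or.inr hw)
      exact continuousAt_const.congr this.symm
  rw [← Complex.integral_comp_polarCoord_symm, polarCoord_target]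
  have hsymm : ∀ p : ℝ × ℝ, Complex.polarCoord.symm p = circleMap 0 p.1 p.2 := fun p => by
    rw [Complex.polarCoord_symm_apply, circleMap, zero_add, Complex.exp_mul_I]
    push_cast; rfl
  have hcm : Continuous fun p : ℝ × ℝ => circleMap 0 p.1 p.2 := by
    simp only [circleMap]; fun_prop
  simp only [hsymm]
  have hcont : Continuous fun p : ℝ × ℝ => p.1 • g (circleMap 0 p.1 p.2) :=
    continuous_fst.smul (hgc.comp hcm)
  have hnorm : ∀ ρ θ : ℝ, 0 < ρ → ‖circleMap 0 ρ θ‖ = ρ := fun ρ θ h => by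
    rw [norm_circleMap_zero, abs_of_pos h]
  have hint : IntegrableOn (fun p : ℝ × ℝ => p.1 • g (circleMap 0 p.1 p.2))
      (Set.Ioi 0 ×ˢ Set.Ioo (-Real.pi) Real.pi) := by
    refine IntegrableOn.of_forall_sdiff_eq_zero (s := Set.Icc 0 r ×ˢ Set.Icc (-Real.pi) Real.pi)
      (hcont.continuousOn.integrableOn_compact (isCompact_Icc.prod isCompact_Icc))
      (measurableSet_Ioi.prod measurableSet_Ioo) ?_
    rintro ⟨ρ, θ⟩ ⟨⟨h1, h2⟩, h3⟩
    have h1' : 0 < ρ := h1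
    have : r ≤ ρ := by
      by_contra! h
      exact h3 ⟨⟨h1'.le, h.le⟩, Set.Ioo_subset_Icc_self h2⟩
    simp only
    rw [hzero _ (Or.inr (by rw [hnorm _ _ h1']; exact hlarge ρ this)), smul_zero]
  rw [Measure.volume_eq_prod, setIntegral_prod _ (by rwa [← Measure.volume_eq_prod])]
  -- The angular integral does not depend on ρ < r, so the double integral splits into a radial
  -- factor times the residue.
  have hinner : ∀ ρ ∈ Set.Ioi (0 : ℝ),
      ∫ θ in Set.Ioo (-Real.pi) Real.pi, ρ • g (circleMap 0 ρ θ) =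
        ((deriv (radialProfile K) (ρ ^ 2) * (2 * ρ) : ℝ) : ℂ) * (4 * Real.pi * c * Q 0) := by
    intro ρ hρ
    have hρ : 0 < ρ := hρ
    by_cases hρr : ρ < r
    · rw [← integral_polar_sq_simplePole hQ hρ hρr c, ← integral_const_mul]
      refine integral_congr_ae (Eventually.of_forall fun θ => ?_)
      simp only [hg]
      rw [hf _ (by simpa [abs_of_pos hρ] using hρr) (circleMap_ne_center hρ.ne'), hnorm _ _ hρ]
      simp only [Complex.real_smul]
      push_cast
      ring
    · have h0 := hlarge ρ (not_lt.1 hρr)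
      rw [deriv_radialProfile_eq_zero (Or.inr h0)]
      have h1 : ∀ θ, g (circleMap 0 ρ θ) = 0 := fun θ =>
        hzero _ (Or.inr (by rw [hnorm ρ θ hρ]; exact h0))
      simp [h1]
  rw [setIntegral_congr_fun measurableSet_Ioi hinner, integral_mul_const, integral_complex_ofReal,
    integral_radialProfile hr hK]
  push_cast; ring

end

/-! ### Integration on the torus, cutoffs and unfolding to the plane -/

section

open Metric

section Integration

variable {E : Type*} [NormedAddCommGroup E] [NormedSpace ℝ E]

lemma continuous_of_smoothAt {n : WithTop ℕ∞} {f : T2 → E} (h : ∀ x, SmoothAt n f x) :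
    Continuous f := continuous_iff_continuousAt.2 fun x => (h x).continuousAt

lemma integrable_of_continuous {E : Type*} [NormedAddCommGroup E] {f : T2 → E} (h : Continuous f) : Integrable f :=
  h.integrable_of_hasCompactSupport (HasCompactSupport.of_compactSpace f)

/-- By translation invariance of Haar measure, the integral of x ↦ g(x + te_k) is constant in t;
differentiate under the integral at t = 0. -/
lemma integral_pd_eq_zero {g : T2 → E} (hg : ∀ x, SmoothAt 1 g x) (k : Fin 2) :
    ∫ x, pd k g x = 0 := by
  have hc : Continuous g := continuous_of_smoothAt hg
  have hpc : Continuous (pd k g) :=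
    continuous_of_smoothAt fun x => (hg x).pd (m := 0) (by simp) k
  obtain ⟨C, hC⟩ := (isCompact_univ (X := T2)).exists_bound_of_continuousOn hpc.continuousOn
  have hd : ∀ (x : T2) (t : ℝ), HasDerivAt
      (fun t : ℝ => g (x + Pi.single k (t : UnitAddCircle)))
      (pd k g (x + Pi.single k (t : UnitAddCircle))) t := by
    intro x t
    have h1 := (hg (x + Pi.single k (t : UnitAddCircle))).hasDerivAt one_ne_zero k
    have h2 : (fun s : ℝ => g (x + Pi.single k (s : UnitAddCircle))) = fun s : ℝ =>
        (fun s : ℝ => g (x + Pi.single k (t : UnitAddCircle) +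
          Pi.single k (s : UnitAddCircle))) (s - t) := by
      ext s
      simp only [add_assoc, ← Pi.single_add, ← AddCircle.coe_add, add_sub_cancel]
    rw [h2]
    rw [← sub_self t] at h1
    simpa using h1.comp_sub_const t t
  have h := hasDerivAt_integral_of_dominated_loc_of_deriv_le (μ := (volume : Measure T2))
    (F := fun (t : ℝ) x => g (x + Pi.single k (t : UnitAddCircle)))
    (F' := fun (t : ℝ) x => pd k g (x + Pi.single k (t : UnitAddCircle)))
    (x₀ := (0 : ℝ)) (s := Set.univ) (bound := fun _ => C) univ_mem
    (Eventually.of_forall fun t => (hc.comp (by fun_prop)).aestronglyMeasurable)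
    (integrable_of_continuous (hc.comp (by fun_prop)))
    (hpc.comp (by fun_prop)).aestronglyMeasurable
    (Eventually.of_forall fun x t _ => hC _ trivial) (integrable_const C)
    (Eventually.of_forall fun x t _ => hd x t)
  have h2 := h.2
  simp only [integral_add_right_eq_self, AddCircle.coe_zero, Pi.single_zero, add_zero] at h2
  exact h2.unique (hasDerivAt_const (0 : ℝ) _)

end Integration

section Cutoff

/-- The squared flat distance to the origin. -/
def tnormSq (x : T2) : ℝ := ‖x 0‖ ^ 2 + ‖x 1‖ ^ 2

lemma continuous_tnormSq : Continuous tnormSq := by unfold tnormSq; fun_prop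

lemma tnormSq_cproj {z : ℂ} (h0 : |z.re| ≤ 1 / 2) (h1 : |z.im| ≤ 1 / 2) :
    tnormSq (cproj z) = ‖z‖ ^ 2 := by
  have key : ∀ t : ℝ, |t| ≤ 1 / 2 → ‖(t : UnitAddCircle)‖ = |t| := fun t ht =>
    (AddCircle.norm_coe_eq_abs_iff 1 one_ne_zero).2 (by simpa using ht)
  simp only [tnormSq, cproj, Matrix.cons_val_zero, Matrix.cons_val_one]
  rw [key _ h0, key _ h1, sq_abs, sq_abs, Complex.sq_norm, Complex.normSq_apply]
  ring

lemma tnormSq_cproj_of_norm {z : ℂ} (h : ‖z‖ ≤ 1 / 2) : tnormSq (cproj z) = ‖z‖ ^ 2 :=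
  tnormSq_cproj ((Complex.abs_re_le_norm z).trans h) ((Complex.abs_im_le_norm z).trans h)

lemma exists_cproj_tnormSq (x : T2) : ∃ z, x = cproj z ∧ tnormSq x = ‖z‖ ^ 2 := by
  obtain ⟨w, rfl⟩ := cproj_surjective x
  have h : cproj w = cproj ⟨w.re - round w.re, w.im - round w.im⟩ := by
    have hr : ∀ n : ℤ, (((n : ℝ)) : UnitAddCircle) = 0 := fun n =>
      (AddCircle.coe_eq_zero_iff 1).2 ⟨n, by simp⟩
    ext k
    fin_cases k <;> simp [cproj, hr]
  exact ⟨_, h, by rw [h]; exact tnormSq_cproj (abs_sub_round _) (abs_sub_round _)⟩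

/-- A smooth radial cutoff at `c`. -/
def cutoff (K : ℝ) (c x : T2) : ℝ := radialProfile K (tnormSq (x - c))

lemma lift_cutoff {K : ℝ} {c : T2} {z : ℂ} (hz : ‖z‖ < 1 / 2) :
    lift c (cutoff K c) =ᶠ[𝓝 z] fun w => radialProfile K (‖w‖ ^ 2) := by
  filter_upwards [(isOpen_Iio.preimage continuous_norm).mem_nhds hz] with w hw
  simp only [lift, cutoff, add_sub_cancel_left]
  rw [tnormSq_cproj_of_norm (le_of_lt hw)]

lemma cutoff_eventually_eq_zero {K : ℝ} {c x : T2} (h : 2 < K * tnormSq (x - c)) :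
    cutoff K c =ᶠ[𝓝 x] fun _ => 0 := by
  have hc : Continuous fun y => K * tnormSq (y - c) :=
    continuous_const.mul (continuous_tnormSq.comp (by fun_prop))
  filter_upwards [(isOpen_Ioi.preimage hc).mem_nhds h] with y hy
  exact radialProfile_eq_zero (le_of_lt hy)

/-- `tnormSq` is not smooth at the cut locus, but 8 < K forces the cutoff to vanish where `tnormSq`
is at least 1/4. Inside that range it is the smooth function |z|². -/
lemma smoothAt_cutoff {K : ℝ} (hK : 8 < K) (n : ℕ∞) (c x : T2) : SmoothAt n (cutoff K c) x := by
  by_cases hx : tnormSq (x - c) < 1 / 4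
  · obtain ⟨z, hz, hz'⟩ := exists_cproj_tnormSq (x - c)
    have hx' : x = c + cproj z := by rw [← hz]; abel
    rw [hx', smoothAt_add_cproj]
    have hn : ‖z‖ < 1 / 2 := by
      rw [hz'] at hx
      nlinarith [norm_nonneg z]
    refine ContDiffAt.congr_of_eventuallyEq ?_ (lift_cutoff hn)
    exact ((contDiff_radialProfile K).comp (contDiff_norm_sq ℝ)).contDiffAt
  · exact (smoothAt_const 0).congr (cutoff_eventually_eq_zero (by nlinarith))

lemma cutoff_nonneg (K : ℝ) (c x : T2) : 0 ≤ cutoff K c x := Real.smoothTransition.nonneg _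

lemma cutoff_eventually_eq_one (K : ℝ) (c : T2) : cutoff K c =ᶠ[𝓝 c] fun _ => 1 := by
  have hc : Continuous fun y => K * tnormSq (y - c) :=
    continuous_const.mul (continuous_tnormSq.comp (by fun_prop))
  filter_upwards [(isOpen_Iio.preimage hc).mem_nhds
    (show c ∈ (fun y => K * tnormSq (y - c)) ⁻¹' Set.Iio 1 by simp [tnormSq])] with y hy
  exact radialProfile_eq_one (le_of_lt hy)

lemma exists_tnormSq_subset {c : T2} {U : Set T2} (hU : U ∈ 𝓝 c) :
    ∃ K, 8 < K ∧ ∀ x, K * tnormSq (x - c) ≤ 2 → x ∈ U := by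
  obtain ⟨ε, hε, hsub⟩ := Metric.mem_nhds_iff.1 hU
  refine ⟨9 + 3 / ε ^ 2, by linarith [show 0 < 3 / ε ^ 2 by positivity], fun x hx => hsub ?_⟩
  have h0 : 0 ≤ tnormSq (x - c) := by unfold tnormSq; positivity
  have h1 : 3 / ε ^ 2 * tnormSq (x - c) ≤ 2 := by nlinarith
  have h2 : tnormSq (x - c) < ε ^ 2 := by
    rw [div_mul_eq_mul_div, div_le_iff₀ (by positivity)] at h1
    nlinarith [show 0 < ε ^ 2 by positivity]
  rw [mem_ball, dist_eq_norm, pi_norm_lt_iff hε]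
  intro k
  have h3 : ‖(x - c) k‖ ^ 2 < ε ^ 2 := by
    refine lt_of_le_of_lt ?_ h2
    unfold tnormSq
    fin_cases k <;> simp
  exact lt_of_pow_lt_pow_left₀ 2 hε.le h3

lemma pd_cutoff {K : ℝ} {c : T2} {z : ℂ} (hz : ‖z‖ < 1 / 2) (k : Fin 2) :
    pd k (cutoff K c) (c + cproj z) =
      deriv (radialProfile K) (‖z‖ ^ 2) * (2 * ![z.re, z.im] k) := by
  have h1 := ((contDiff_radialProfile K (n := 1)).differentiable (by simp) (‖z‖ ^ 2)).hasDerivAt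
  have h2 : HasFDerivAt (fun w : ℂ => ‖w‖ ^ 2) (2 • innerSL ℝ z) z :=
    (hasStrictFDerivAt_norm_sq z).hasFDerivAt
  have h3 := (HasDerivAt.comp_hasFDerivAt z (f := fun w : ℂ => ‖w‖ ^ 2) h1 h2).congr_of_eventuallyEq
    (lift_cutoff (K := K) (c := c) hz)
  rw [pd_eq_fderiv k h3.differentiableAt, h3.fderiv]
  fin_cases k <;> simp [dir, Complex.inner]

/-- The factor z in ∂̄χ is what turns the angular integral into a contour integral. -/
lemma cpd_cutoff {K : ℝ} {c : T2} {z : ℂ} (hz : ‖z‖ < 1 / 2) :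
    ((pd 0 (cutoff K c) (c + cproj z) : ℝ) : ℂ) + Complex.I * (pd 1 (cutoff K c) (c + cproj z) : ℝ) =
      ((deriv (radialProfile K) (‖z‖ ^ 2) : ℝ) : ℂ) * (2 * z) := by
  rw [pd_cutoff hz, pd_cutoff hz]
  apply Complex.ext <;> simp

end Cutoff

/-- Unfolding of an integral of a function supported in a disc. -/
lemma integral_eq_integral_complex {E : Type*} [NormedAddCommGroup E] [NormedSpace ℝ E]
    {g : T2 → E} (hg : Continuous g) {g₀ : ℂ → E} (c : T2)
    (h : ∀ z, ‖z‖ < 1 / 2 → g (c + cproj z) = g₀ z)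
    (h0 : ∀ z, 1 / 2 ≤ ‖z‖ → g₀ z = 0)
    (h1 : ∀ x, 1 / 4 ≤ tnormSq (x - c) → g x = 0) :
    ∫ x, g x = ∫ z, g₀ z := by
  have mp : MeasurePreserving (fun (y : Fin 2 → ℝ) (k : Fin 2) => (y k : UnitAddCircle))
      (Measure.pi fun _ => volume.restrict (Set.Ioc (-(1 / 2) : ℝ) (-(1 / 2) + 1)))
      (Measure.pi fun _ => volume) :=
    measurePreserving_pi _ _ fun _ => AddCircle.measurePreserving_mk 1 (-(1 / 2))
  rw [← integral_add_left_eq_self g c]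
  have e1 : ∫ x : T2, g (c + x) = ∫ y, g (c + fun k => ((y k : ℝ) : UnitAddCircle))
      ∂(Measure.pi fun _ : Fin 2 => volume.restrict (Set.Ioc (-(1 / 2) : ℝ) (-(1 / 2) + 1))) := by
    rw [volume_pi, ← mp.map_eq, integral_map mp.measurable.aemeasurable]
    exact (hg.comp (by fun_prop)).aestronglyMeasurable
  have hz : ∀ y : Fin 2 → ℝ, (fun k => ((y k : ℝ) : UnitAddCircle)) =
      cproj (Complex.measurableEquivPi.symm y) := by
    intro y; ext k; fin_cases k <;> simp [cproj, Complex.measurableEquivPi]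
  rw [e1, ← Measure.restrict_pi_pi, ← volume_pi]
  have e2 : ∫ y in Set.univ.pi fun _ : Fin 2 => Set.Ioc (-(1 / 2) : ℝ) (-(1 / 2) + 1),
      g (c + fun k => ((y k : ℝ) : UnitAddCircle)) =
      ∫ y in Set.univ.pi fun _ : Fin 2 => Set.Ioc (-(1 / 2) : ℝ) (-(1 / 2) + 1),
        g₀ (Complex.measurableEquivPi.symm y) := by
    refine setIntegral_congr_fun (MeasurableSet.univ_pi fun _ => measurableSet_Ioc) ?_
    intro y hy
    simp only [hz]
    -- In the corners of the fundamental square, outside the disc of radius 1/2, both integrands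
    -- vanish.
    by_cases hn : ‖Complex.measurableEquivPi.symm y‖ < 1 / 2
    · exact h _ hn
    · have hn := not_lt.1 hn
      rw [h0 _ hn, h1]
      rw [add_sub_cancel_left, tnormSq_cproj]
      · nlinarith
      · have := hy 0 trivial
        simp only [Complex.measurableEquivPi_symm_apply]
        simp
        exact abs_le.2 ⟨by linarith [this.1], by linarith [this.2]⟩
      · have := hy 1 trivial
        simp
        exact abs_le.2 ⟨by linarith [this.1], by linarith [this.2]⟩
  rw [e2, setIntegral_eq_integral_of_forall_compl_eq_zero]
  · exact (Complex.volume_preserving_equiv_pi.symm _).integral_comp'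
      (g := g₀)
  · intro y hy
    apply h0
    by_contra! hlt
    apply hy
    intro k _
    have a0 := (Complex.abs_re_le_norm _).trans_lt hlt
    have a1 := (Complex.abs_im_le_norm _).trans_lt hlt
    simp at a0 a1
    rw [abs_lt] at a0 a1
    fin_cases k
    · exact ⟨by simp; linarith, by simp; linarith⟩
    · exact ⟨by simp; linarith, by simp; linarith⟩

end

/-! ### The Laplacian and the Green's function -/

section

open InnerProductSpace Metric Laplacian

section Laplace

variable {n : WithTop ℕ∞} {x : T2}

lemma lift_pd_eventuallyEq {E : Type*} [NormedAddCommGroup E] [NormedSpace ℝ E]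
    {f : T2 → E} {w : ℂ} (h : SmoothAt 1 f (x + cproj w)) (k : Fin 2) :
    lift x (pd k f) =ᶠ[𝓝 w] fun v => fderiv ℝ (lift x f) v (dir k) := by
  filter_upwards [((smoothAt_add_cproj w).1 h).eventually (by simp)] with v hv
  exact pd_eq_fderiv k (hv.differentiableAt (by simp))

lemma pd_pd_eq {E : Type*} [NormedAddCommGroup E] [NormedSpace ℝ E] {f : T2 → E} {w : ℂ}
    (h : SmoothAt 2 f (x + cproj w)) (k l : Fin 2) :
    pd l (pd k f) (x + cproj w) = fderiv ℝ (fderiv ℝ (lift x f)) w (dir l) (dir k) := by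
  have h1 : SmoothAt 1 (pd k f) (x + cproj w) := h.pd (by norm_num) k
  have h2 : ContDiffAt ℝ 2 (lift x f) w := (smoothAt_add_cproj w).1 h
  have h3 : DifferentiableAt ℝ (fderiv ℝ (lift x f)) w :=
    (h2.fderiv_right (m := 1) (by norm_num)).differentiableAt (by simp)
  rw [pd_eq_fderiv l (((smoothAt_add_cproj w).1 h1).differentiableAt (by simp)),
    (lift_pd_eventuallyEq (h.of_le (by norm_num)) k).fderiv_eq,
    fderiv_clm_apply h3 (differentiableAt_const _)]
  simp

lemma pd_comm {E : Type*} [NormedAddCommGroup E] [NormedSpace ℝ E] {f : T2 → E}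
    (h : SmoothAt 2 f x) (k l : Fin 2) :
    pd l (pd k f) x = pd k (pd l f) x := by
  have h' : SmoothAt 2 f (x + cproj 0) := by simpa using h
  have h1 := pd_pd_eq h' k l
  have h2 := pd_pd_eq h' l k
  have h3 : ContDiffAt ℝ 2 (lift x f) 0 := h
  rw [cproj_zero, add_zero] at h1 h2
  rw [h1, h2]
  exact (h3.isSymmSndFDerivAt (by simp)) _ _

lemma laplacian_lift {u : T2 → ℝ} {w : ℂ} (h : SmoothAt 2 u (x + cproj w)) :
    Δ (lift x u) w = lap u (x + cproj w) := by
  rw [laplacian_eq_iteratedFDeriv_complexPlane, lap, Fin.sum_univ_two, pd_pd_eq h, pd_pd_eq h]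
  simp [iteratedFDeriv_two_apply, dir]

lemma harmonicAt_lift {u : T2 → ℝ} {w : ℂ} (h : SmoothAt 2 u (x + cproj w))
    (hl : ∀ᶠ y in 𝓝 (x + cproj w), lap u y = 0) : HarmonicAt (lift x u) w := by
  have h1 := (smoothAt_add_cproj w).1 h
  refine ⟨h1, ?_⟩
  filter_upwards [h1.eventually (by simp), (tendsto_cproj x w).eventually hl] with v hv hv'
  rw [laplacian_lift ((smoothAt_add_cproj v).2 hv)]
  exact hv'

lemma SmoothAt.lap {u : T2 → ℝ} (h : SmoothAt 2 u x) : SmoothAt 0 (lap u) x :=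
  SmoothAt.sum fun k _ => (h.pd (m := 1) (by norm_num) k).pd (by norm_num) k

lemma SmoothAt.mul_of_eventually_eq_zero {A : Type*} [NormedRing A] [NormedAlgebra ℝ A]
    {f g : T2 → A} (h : SmoothAt n f x ∧ SmoothAt n g x ∨ g =ᶠ[𝓝 x] fun _ => 0) :
    SmoothAt n (fun y => f y * g y) x := by
  rcases h with ⟨h1, h2⟩ | h
  · exact h1.mul h2
  · refine (smoothAt_const 0).congr ?_
    filter_upwards [h] with y hy
    rw [hy, mul_zero]

end Laplace

section Green

lemma tendsto_neg_punctured : Tendsto (fun z : ℂ => -z) (𝓝[≠] 0) (𝓝[≠] 0) := by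
  refine tendsto_nhdsWithin_iff.2 ⟨?_, ?_⟩
  · have := (continuous_neg (G := ℂ)).tendsto 0
    rw [neg_zero] at this
    exact this.mono_left nhdsWithin_le_nhds
  · filter_upwards [self_mem_nhdsWithin] with z hz
    simpa using hz

variable {F : T2 → ℝ}

lemma IsGreen.smoothAt (hF : IsGreen F) {x : T2} (hx : x ≠ 0) : SmoothAt 2 F x :=
  hF.contDiffOn.smoothAt (isOpen_compl_singleton.mem_nhds hx)

lemma IsGreen.tendsto_sub_log (hF : IsGreen F) :
    Tendsto (fun z : ℂ => F (cproj z) - Real.log ‖z‖) (𝓝[≠] 0) (𝓝 0) := by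
  have h : Tendsto (fun z : ℂ => Complex.orthonormalBasisOneI.repr z) (𝓝[≠] 0) (𝓝[≠] 0) := by
    refine tendsto_nhdsWithin_iff.2 ⟨?_, ?_⟩
    · have := (LinearIsometryEquiv.continuous Complex.orthonormalBasisOneI.repr).tendsto 0
      rw [map_zero] at this
      exact this.mono_left nhdsWithin_le_nhds
    · filter_upwards [self_mem_nhdsWithin] with z hz
      simpa using hz
  have := hF.normalized.comp h
  refine this.congr fun z => ?_
  simp only [Function.comp_apply, LinearIsometryEquiv.norm_map, ← cproj_eq_proj]

/-- Green's second identity against a test function vanishing near the pole. -/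
lemma integral_mul_lap_comm (hF : ∀ x, x ≠ 0 → SmoothAt 2 F x) {φ : T2 → ℝ}
    (hφ : ∀ x, SmoothAt 2 φ x) (h0 : φ =ᶠ[𝓝 0] fun _ => 0) :
    Integrable (fun x => lap F x * φ x) ∧ ∫ x, F x * lap φ x = ∫ x, lap F x * φ x := by
  have hp1 : ∀ k, pd k φ =ᶠ[𝓝 0] fun _ => 0 := fun k => by
    filter_upwards [pd_eventuallyEq k h0] with y hy
    rw [hy, pd_const]
  have hp2 : ∀ k, pd k (pd k φ) =ᶠ[𝓝 0] fun _ => 0 := fun k => by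
    filter_upwards [pd_eventuallyEq k (hp1 k)] with y hy
    rw [hy, pd_const]
  have hl : lap φ =ᶠ[𝓝 0] fun _ => 0 := by
    filter_upwards [hp2 0, hp2 1] with y h1 h2
    rw [lap, Fin.sum_univ_two, h1, h2, add_zero]
  -- Green's vector field, with divergence F Δφ - φ ΔF. It is C¹ even at the pole, since φ vanishes
  -- nearby.
  set W : Fin 2 → T2 → ℝ := fun k x => F x * pd k φ x - pd k F x * φ x with hW
  have hWs : ∀ k x, SmoothAt 1 (W k) x := by
    intro k x
    refine SmoothAt.sub (SmoothAt.mul_of_eventually_eq_zero ?_)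
      (SmoothAt.mul_of_eventually_eq_zero ?_)
    · by_cases hx : x = 0
      · subst hx; exact Or.inr (hp1 k)
      · exact Or.inl ⟨(hF x hx).of_le (by norm_num), (hφ x).pd (by norm_num) k⟩
    · by_cases hx : x = 0
      · subst hx; exact Or.inr h0
      · exact Or.inl ⟨(hF x hx).pd (by norm_num) k, (hφ x).of_le (by norm_num)⟩
  have hWd : ∀ k x, pd k (W k) x = F x * pd k (pd k φ) x - pd k (pd k F) x * φ x := by
    intro k x
    by_cases hx : x = 0
    · subst hx
      rw [(hp2 k).eq_of_nhds, h0.eq_of_nhds, pd_eq_zero k (c := (0 : ℝ))]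
      · simp
      · filter_upwards [hp1 k, h0] with y h1 h2
        simp [hW, h1, h2]
    · have f1 : SmoothAt 1 F x := (hF x hx).of_le (by norm_num)
      have f2 : SmoothAt 1 (pd k F) x := (hF x hx).pd (by norm_num) k
      have g1 : SmoothAt 1 φ x := (hφ x).of_le (by norm_num)
      have g2 : SmoothAt 1 (pd k φ) x := (hφ x).pd (by norm_num) k
      rw [hW, pd_sub (f1.mul g2) (f2.mul g1), pd_mul f1 g2, pd_mul f2 g1]
      ring
  have hsum : ∀ x, pd 0 (W 0) x + pd 1 (W 1) x = F x * lap φ x - lap F x * φ x := by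
    intro x
    rw [hWd, hWd, lap, lap, Fin.sum_univ_two, Fin.sum_univ_two]
    ring
  have i1 : Integrable fun x => F x * lap φ x := by
    refine integrable_of_continuous (continuous_of_smoothAt (n := 0) fun x => ?_)
    refine SmoothAt.mul_of_eventually_eq_zero ?_
    by_cases hx : x = 0
    · subst hx; exact Or.inr hl
    · exact Or.inl ⟨(hF x hx).of_le (by norm_num), (hφ x).lap⟩
  have i2 : Integrable fun x => lap F x * φ x := by
    refine integrable_of_continuous (continuous_of_smoothAt (n := 0) fun x => ?_)
    refine SmoothAt.mul_of_eventually_eq_zero ?_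
    by_cases hx : x = 0
    · subst hx; exact Or.inr h0
    · exact Or.inl ⟨(hF x hx).lap, (hφ x).of_le (by norm_num)⟩
  refine ⟨i2, sub_eq_zero.1 ?_⟩
  have i3 : ∀ k, Integrable (pd k (W k)) := fun k => integrable_of_continuous
    (continuous_of_smoothAt (n := 0) fun x => (hWs k x).pd (by norm_num) k)
  rw [← integral_sub i1 i2, ← integral_congr_ae (Eventually.of_forall hsum),
    integral_add (i3 0) (i3 1), integral_pd_eq_zero (hWs 0), integral_pd_eq_zero (hWs 1), add_zero]

/-- If c = ΔF(x) + 2π were nonzero, c(ΔF + 2π) would be positive near x. Tested against a bump there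
that avoids the pole, its integral would be positive, while the distributional equation makes it
zero. -/
lemma IsGreen.lap_eq (hF : IsGreen F) {x : T2} (hx : x ≠ 0) : lap F x = -(2 * Real.pi) := by
  by_contra hne
  set c := lap F x + 2 * Real.pi with hc
  have hc0 : c ≠ 0 := fun h => hne (by linarith)
  have hcont : ContinuousAt (fun y => c * (lap F y + 2 * Real.pi)) x :=
    continuousAt_const.mul (((hF.smoothAt hx).lap.continuousAt).add continuousAt_const)
  have hpos : ∀ᶠ y in 𝓝 x, 0 < c * (lap F y + 2 * Real.pi) :=
    hcont.eventually_const_lt (mul_self_pos.2 hc0)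
  obtain ⟨K, hK, hKU⟩ := exists_tnormSq_subset (hpos.and (isOpen_ne.mem_nhds hx))
  set φ := cutoff K x with hφ
  have h0 : φ =ᶠ[𝓝 0] fun _ => 0 := by
    refine cutoff_eventually_eq_zero ?_
    by_contra! h
    exact (hKU 0 h).2 rfl
  have hsm : ∀ y, SmoothAt 2 φ y := fun y => smoothAt_cutoff hK 2 x y
  obtain ⟨i1, e1⟩ := integral_mul_lap_comm (fun y hy => hF.smoothAt hy) hsm h0
  rw [hF.laplacian φ (torusContDiff_of_smoothAt fun y => smoothAt_cutoff hK ⊤ x y),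
    h0.eq_of_nhds] at e1
  have i2 : Integrable fun y => 2 * Real.pi * φ y :=
    (integrable_of_continuous (continuous_of_smoothAt hsm)).const_mul _
  have hint : ∫ y, c * (lap F y + 2 * Real.pi) * φ y = 0 := by
    have : ∀ y, c * (lap F y + 2 * Real.pi) * φ y = c * (lap F y * φ y + 2 * Real.pi * φ y) :=
      fun y => by ring
    simp only [this]
    rw [integral_const_mul, integral_add i1 i2, ← e1, integral_const_mul]
    ring
  have hcts : Continuous fun y => c * (lap F y + 2 * Real.pi) * φ y := by
    refine continuous_of_smoothAt (n := 0) fun y => SmoothAt.mul_of_eventually_eq_zero ?_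
    by_cases hy : y = 0
    · subst hy; exact Or.inr h0
    · exact Or.inl ⟨(smoothAt_const c).mul ((hF.smoothAt hy).lap.add (smoothAt_const _)),
        (hsm y).of_le (by norm_num)⟩
  have hnonneg : 0 ≤ fun y => c * (lap F y + 2 * Real.pi) * φ y := by
    intro y
    by_cases hy : K * tnormSq (y - x) ≤ 2
    · exact mul_nonneg (hKU y hy).1.le (cutoff_nonneg K x y)
    · have : φ y = 0 := radialProfile_eq_zero (not_le.1 hy).le
      simp [this]
  have := hcts.integral_pos_of_hasCompactSupport_nonneg_nonzero (μ := (volume : Measure T2))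
    (HasCompactSupport.of_compactSpace _) hnonneg (x := x) (by
      rw [hφ, (cutoff_eventually_eq_one K x).eq_of_nhds]
      rw [← hc]; simpa using hc0)
  rw [hint] at this
  exact lt_irrefl _ this

lemma lap_sub_comp_neg (hF : IsGreen F) {x : T2} (hx : x ≠ 0) :
    lap (fun y => F y - F (-y)) x = 0 := by
  have hnx : -x ≠ 0 := neg_ne_zero.2 hx
  have e : ∀ k, pd k (pd k fun y => F y - F (-y)) x = pd k (pd k F) x - pd k (pd k F) (-x) := by
    intro k
    have h1 : pd k (fun y => F y - F (-y)) =ᶠ[𝓝 x] fun y => pd k F y + pd k F (-y) := by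
      filter_upwards [isOpen_ne.mem_nhds hx] with y hy
      rw [pd_sub ((hF.smoothAt hy).of_le (by norm_num))
        (((hF.smoothAt (neg_ne_zero.2 hy)).of_le (by norm_num)).comp_neg), pd_comp_neg]
      ring
    rw [pd_congr k h1, pd_add ((hF.smoothAt hx).pd (by norm_num) k)
      (((hF.smoothAt hnx).pd (by norm_num) k).comp_neg), pd_comp_neg]
    ring
  have h1 := hF.lap_eq hx
  have h2 := hF.lap_eq hnx
  rw [lap, Fin.sum_univ_two] at h1 h2 ⊢
  rw [e, e]
  linarith

/-- The Green's function is even. -/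
lemma IsGreen.even (hF : IsGreen F) (x : T2) : F (-x) = F x := by
  set G : T2 → ℝ := fun y => F y - F (-y) with hG
  have hsm : ∀ y, y ≠ 0 → SmoothAt 2 G y := fun y hy =>
    (hF.smoothAt hy).sub (hF.smoothAt (neg_ne_zero.2 hy)).comp_neg
  -- At the origin the logarithms in F(z) and F(-z) cancel, so the normalization gives the limit 0 =
  -- G(0).
  have hcont : Continuous G := by
    rw [continuous_iff_continuousAt]
    intro y
    by_cases hy : y = 0
    · subst hy
      refine continuousAt_of_lift ?_
      rw [continuousAt_iff_punctured_nhds, lift_zero]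
      have h1 := hF.tendsto_sub_log
      have h2 := h1.sub (h1.comp tendsto_neg_punctured)
      have e0 : G 0 = 0 - 0 := by simp [hG]
      rw [e0]
      refine h2.congr fun z => ?_
      simp [hG, lift, cproj_neg]
    · exact (hsm y hy).continuousAt
  have hodd : ∀ y, G (-y) = -G y := fun y => by simp [hG]
  have hle : ∀ y, G y ≤ 0 := by
    obtain ⟨y, -, hy⟩ := (isCompact_univ (X := T2)).exists_isMaxOn Set.univ_nonempty
      hcont.continuousOn
    by_contra! hpos
    obtain ⟨w, hw⟩ := hpos
    have hyp : 0 < G y := hw.trans_le (hy trivial)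
    -- Strong maximum principle: a positive maximum is not attained at 0, the only point where G may
    -- fail to be harmonic. The set of maximum points is thus clopen, hence the whole torus,
    -- contradicting G(0) = 0.
    have hopen : IsOpen {t | G t = G y} := by
      rw [isOpen_iff_mem_nhds]
      intro t ht
      have ht : G t = G y := ht
      have ht0 : t ≠ 0 := by
        rintro rfl
        have : G 0 = 0 := by simp [hG]
        linarith
      have hharm : HarmonicAt (lift t G) 0 := by
        refine harmonicAt_lift (by simpa using hsm t ht0) ?_
        rw [cproj_zero, add_zero]
        filter_upwards [isOpen_ne.mem_nhds ht0] with s hs using lap_sub_comp_neg hF hs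
      have hmax : IsLocalMax (lift t G) 0 := Eventually.of_forall fun z => by
        rw [lift_zero, ht]; exact hy trivial
      have := eventually_eq_of_isLocalMax_harmonic hharm hmax
      have h2 := map_nhds_cproj t 0
      rw [cproj_zero, add_zero] at h2
      rw [← h2, mem_map]
      filter_upwards [this] with z hz
      rw [lift_zero, ht] at hz
      exact hz
    have hclosed : IsClosed {t | G t = G y} := isClosed_eq hcont continuous_const
    have huniv := IsClopen.eq_univ ⟨hclosed, hopen⟩ ⟨y, rfl⟩
    have : (0 : T2) ∈ {t | G t = G y} := by rw [huniv]; trivial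
    have h0 : G 0 = G y := this
    have : G 0 = 0 := by simp [hG]
    linarith
  have h1 := hle x
  have h2 := hle (-x)
  rw [hodd] at h2
  have : G x = 0 := le_antisymm h1 (by linarith)
  simp only [hG] at this
  linarith

end Green

end

/-! ### The operator ∂̄ and the local structure of the potential -/

section

open InnerProductSpace Metric

section Local

/-- The complex derivative `u_x - i u_y` on the torus. -/
def tgrad (u : T2 → ℝ) (x : T2) : ℂ := (pd 0 u x : ℝ) - Complex.I * (pd 1 u x : ℝ)

/-- The operator `∂_x + i ∂_y` on the torus. -/
def dbar (g : T2 → ℂ) (x : T2) : ℂ := pd 0 g x + Complex.I * pd 1 g x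

variable {x : T2}

lemma tgrad_eq_cgrad {u : T2 → ℝ} {w : ℂ} (h : DifferentiableAt ℝ (lift x u) w) :
    tgrad u (x + cproj w) = cgrad (lift x u) w := by
  rw [tgrad, cgrad, pd_eq_fderiv 0 h, pd_eq_fderiv 1 h]
  simp [dir]

lemma SmoothAt.tgrad {n m : WithTop ℕ∞} {u : T2 → ℝ} (h : SmoothAt n u x) (hm : m + 1 ≤ n) :
    SmoothAt m (tgrad u) x :=
  (h.pd hm 0).ofReal.sub ((smoothAt_const _).mul (h.pd hm 1).ofReal)

lemma dbar_tgrad {u : T2 → ℝ} (h : SmoothAt 2 u x) (hl : ∀ᶠ y in 𝓝 x, lap u y = 0) :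
    dbar (tgrad u) x = 0 := by
  have hh : HarmonicAt (lift x u) 0 := harmonicAt_lift (by simpa using h) (by simpa using hl)
  have hd : DifferentiableAt ℂ (cgrad (lift x u)) 0 :=
    HarmonicAt.differentiableAt_complex_partial hh
  have he : lift x (tgrad u) =ᶠ[𝓝 0] cgrad (lift x u) := by
    filter_upwards [ContDiffAt.eventually h (by simp)] with w hw
    exact tgrad_eq_cgrad (hw.differentiableAt (by simp))
  have hr : HasFDerivAt (lift x (tgrad u))
      ((fderiv ℂ (cgrad (lift x u)) 0).restrictScalars ℝ) (0 : ℂ) :=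
    (hd.hasFDerivAt.restrictScalars ℝ).congr_of_eventuallyEq he
  have hk : ∀ k, pd k (tgrad u) x = fderiv ℂ (cgrad (lift x u)) 0 (dir k) := fun k => by
    have := pd_eq_fderiv (x := x) k hr.differentiableAt
    rw [cproj_zero, add_zero, hr.fderiv] at this
    exact this
  rw [dbar, hk, hk]
  simp only [dir, Matrix.cons_val_zero, Matrix.cons_val_one]
  rw [fderiv_eq_smul_deriv, fderiv_eq_smul_deriv, smul_eq_mul, smul_eq_mul]
  linear_combination (deriv (cgrad (lift x u)) 0) * Complex.I_mul_I

lemma dbar_mul {f g : T2 → ℂ} (hf : SmoothAt 1 f x) (hg : SmoothAt 1 g x) :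
    dbar (fun y => f y * g y) x = dbar f x * g x + f x * dbar g x := by
  rw [dbar, pd_mul hf hg, pd_mul hf hg, dbar, dbar]; ring

lemma dbar_eq_zero {g : T2 → ℂ} {c : ℂ} (h : g =ᶠ[𝓝 x] fun _ => c) : dbar g x = 0 := by
  rw [dbar, pd_eq_zero 0 h, pd_eq_zero 1 h, mul_zero, add_zero]

lemma dbar_eventuallyEq_zero {g : T2 → ℂ} {c : ℂ} (h : g =ᶠ[𝓝 x] fun _ => c) :
    dbar g =ᶠ[𝓝 x] fun _ => 0 := by
  filter_upwards [h.eventuallyEq_nhds] with y hy using dbar_eq_zero hy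

lemma SmoothAt.dbar {n m : WithTop ℕ∞} {g : T2 → ℂ} (h : SmoothAt n g x) (hm : m + 1 ≤ n) :
    SmoothAt m (dbar g) x :=
  (h.pd hm 0).add ((smoothAt_const _).mul (h.pd hm 1))

lemma integral_dbar_eq_zero {g : T2 → ℂ} (hg : ∀ x, SmoothAt 1 g x) : ∫ x, dbar g x = 0 := by
  have hi : ∀ k, Integrable (pd k g) := fun k => integrable_of_continuous
    (continuous_of_smoothAt (n := 0) fun x => (hg x).pd (by norm_num) k)
  simp only [dbar]
  rw [integral_add (hi 0) ((hi 1).const_mul _), integral_const_mul, integral_pd_eq_zero hg,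
    integral_pd_eq_zero hg, mul_zero, add_zero]

lemma eventually_const_of_pd_eq_zero {p : T2 → ℝ} {c : T2} (hp : ∀ x, SmoothAt 1 p x)
    (h : ∀ᶠ x in 𝓝 c, ∀ k, pd k p x = 0) : p =ᶠ[𝓝 c] fun _ => p c := by
  have hd : ∀ w, DifferentiableAt ℝ (lift c p) w := fun w =>
    ((smoothAt_add_cproj w).1 (hp _)).differentiableAt (by simp)
  have h2 := map_nhds_cproj c 0
  rw [cproj_zero, add_zero] at h2
  rw [← h2, eventually_map] at h
  obtain ⟨R, hR, hR'⟩ := Metric.eventually_nhds_iff_ball.1 h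
  have hz : ∀ w ∈ ball (0 : ℂ) R, fderiv ℝ (lift c p) w = 0 := by
    intro w hw
    have h0 := hR' w hw 0
    have h1 := hR' w hw 1
    rw [pd_eq_fderiv _ (hd w)] at h0 h1
    ext v
    have : v = v.re • dir 0 + v.im • dir 1 := by
      apply Complex.ext <;> simp [dir]
    rw [this, map_add, map_smul, map_smul, h0, h1]
    simp
  rw [EventuallyEq, ← h2, eventually_map]
  filter_upwards [ball_mem_nhds (0 : ℂ) hR] with w hw
  have := (convex_ball (0 : ℂ) R).is_const_of_fderivWithin_eq_zero (𝕜 := ℝ)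
    (f := lift c p) (fun v _ => (hd v).differentiableWithinAt)
    (fun v hv => by rw [fderivWithin_of_isOpen isOpen_ball hv]; exact hz v hv)
    hw (mem_ball_self hR)
  rw [lift_zero] at this
  exact this

end Local

section Potential

variable {F : T2 → ℝ} {m : ℕ} {a : Fin m → T2} {d : Fin m → ℤ}

lemma smoothAt_potential (hF : IsGreen F) {x : T2} (hx : x ∉ Set.range a) :
    SmoothAt 2 (potential F a d) x :=
  SmoothAt.sum fun j _ => (smoothAt_const _).mul (hF.smoothAt
    (fun h => hx ⟨j, (sub_eq_zero.1 h).symm⟩)).sub_const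

lemma eventually_notMem_range {x : T2} (hx : x ∉ Set.range a) : ∀ᶠ y in 𝓝 x, y ∉ Set.range a :=
  (Set.finite_range a).isClosed.isOpen_compl.mem_nhds hx

lemma pd_sum_green (hF : IsGreen F) (s : Finset (Fin m)) {x : T2} (hx : ∀ j ∈ s, x ≠ a j)
    (k : Fin 2) :
    pd k (fun y => ∑ j ∈ s, (d j : ℝ) * F (y - a j)) x = ∑ j ∈ s, (d j : ℝ) * pd k F (x - a j) := by
  have h : ∀ j ∈ s, SmoothAt 1 (fun y => F (y - a j)) x := fun j hj =>
    ((hF.smoothAt (sub_ne_zero.2 (hx j hj))).of_le (by norm_num)).sub_const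
  rw [pd_sum fun j hj => (smoothAt_const _).mul (h j hj)]
  refine Finset.sum_congr rfl fun j hj => ?_
  rw [pd_const_mul _ (h j hj), pd_comp_sub]

lemma lap_potential (hF : IsGreen F) (hd : ∑ j, d j = 0) {x : T2} (hx : x ∉ Set.range a) :
    lap (potential F a d) x = 0 := by
  have hne : ∀ y, y ∉ Set.range a → ∀ j ∈ Finset.univ, y ≠ a j := fun y hy j _ h => hy ⟨j, h.symm⟩
  have h1 : ∀ k, pd k (pd k (potential F a d)) x = ∑ j, (d j : ℝ) * pd k (pd k F) (x - a j) := by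
    intro k
    have : pd k (potential F a d) =ᶠ[𝓝 x] fun y => ∑ j, (d j : ℝ) * pd k F (y - a j) := by
      filter_upwards [eventually_notMem_range hx] with y hy
      exact pd_sum_green hF _ (hne y hy) k
    have hs : ∀ j ∈ Finset.univ, SmoothAt 1 (fun y => pd k F (y - a j)) x := fun j hj =>
      ((hF.smoothAt (sub_ne_zero.2 (hne x hx j hj))).pd (by norm_num) k).sub_const
    rw [pd_congr k this, pd_sum fun j hj => (smoothAt_const _).mul (hs j hj)]
    refine Finset.sum_congr rfl fun j hj => ?_
    rw [pd_const_mul _ (hs j hj), pd_comp_sub]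
  rw [lap, Fin.sum_univ_two, h1, h1, ← Finset.sum_add_distrib]
  have h2 : ∀ j ∈ Finset.univ, (d j : ℝ) * pd 0 (pd 0 F) (x - a j) +
      d j * pd 1 (pd 1 F) (x - a j) = d j * -(2 * Real.pi) := fun j hj => by
    rw [← hF.lap_eq (sub_ne_zero.2 (hne x hx j hj)), lap, Fin.sum_univ_two]; ring
  rw [Finset.sum_congr rfl h2, ← Finset.sum_mul, ← Int.cast_sum, hd]
  simp

lemma eventually_lap_potential (hF : IsGreen F) (hd : ∑ j, d j = 0) {x : T2}
    (hx : x ∉ Set.range a) : ∀ᶠ y in 𝓝 x, lap (potential F a d) y = 0 := by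
  filter_upwards [eventually_notMem_range hx] with y hy using lap_potential hF hd hy

lemma cproj_ne_zero {z : ℂ} (h : ‖z‖ ≤ 1 / 2) (hz : z ≠ 0) : cproj z ≠ 0 := by
  intro h0
  have := tnormSq_cproj_of_norm h
  rw [h0] at this
  have h1 : tnormSq 0 = 0 := by simp [tnormSq]
  rw [h1] at this
  exact hz (by simpa using this.symm)

/-- Distinctness of the points excludes the other vortices; the cap 1/2 excludes other lifts of `a
i` itself. -/
lemma exists_isolating_radius (ha : Function.Injective a) (i : Fin m) :
    ∃ r, 0 < r ∧ r ≤ 1 / 2 ∧ ∀ z : ℂ, ‖z‖ < r → z ≠ 0 → a i + cproj z ∉ Set.range a := by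
  have h1 : ∀ᶠ x in 𝓝 (a i), ∀ j, j ≠ i → x ≠ a j := by
    rw [eventually_all]
    intro j
    by_cases hj : j = i
    · exact Eventually.of_forall fun x h => absurd hj h
    · filter_upwards [isOpen_ne.mem_nhds (ha.ne (Ne.symm hj))] with x hx _ using hx
  have h2 := map_nhds_cproj (a i) 0
  rw [cproj_zero, add_zero] at h2
  rw [← h2, eventually_map] at h1
  obtain ⟨R, hR, hR'⟩ := Metric.eventually_nhds_iff_ball.1 h1
  refine ⟨min R (1 / 2), by positivity, min_le_right _ _, ?_⟩
  rintro z hz hz0 ⟨j, hj⟩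
  by_cases hji : j = i
  · subst hji
    exact cproj_ne_zero (hz.le.trans (min_le_right _ _)) hz0 (by simpa using hj.symm)
  · exact hR' z (by simpa using hz.trans_le (min_le_left _ _)) j hji hj.symm

/-- Local structure of the complex derivative of the potential at a vortex. -/
lemma exists_simplePole (hF : IsGreen F) (hd : ∑ j, d j = 0) (i : Fin m) {r : ℝ} (hr : 0 < r)
    (hr2 : r ≤ 1 / 2) (ha : Function.Injective a)
    (hra : ∀ z : ℂ, ‖z‖ < r → z ≠ 0 → a i + cproj z ∉ Set.range a) :
    ∃ Q : ℂ → ℂ, DifferentiableOn ℂ Q (ball 0 r) ∧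
      (∀ z ∈ ball (0 : ℂ) r, z ≠ 0 →
        tgrad (potential F a d) (a i + cproj z) = (d i : ℂ) * z⁻¹ + Q z) ∧
      Q 0 = ∑ j with j ≠ i, (d j : ℂ) * tgrad F (a i - a j) := by
  set c := a i with hc
  set u := lift c (potential F a d) with hu
  set Ψ : T2 → ℝ := fun x => ∑ j with j ≠ i, (d j : ℝ) * F (x - a j) with hΨ
  set v : ℂ → ℝ := fun z => F (cproj z) - Real.log ‖z‖ with hv
  set h : ℂ → ℝ := fun z => u z - (d i : ℝ) * Real.log ‖z‖ with hh
  have hne : ∀ j ∈ Finset.univ.filter (fun j => j ≠ i), c ≠ a j := fun j hj =>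
    ha.ne (Ne.symm (Finset.mem_filter.1 hj).2)
  have hΨs : SmoothAt 2 Ψ c := SmoothAt.sum fun j hj =>
    (smoothAt_const _).mul (hF.smoothAt (sub_ne_zero.2 (hne j hj))).sub_const
  -- The two forms of h serve different ends: as Φ minus a logarithm it is harmonic, while this
  -- splitting gives its limit at 0 and exposes the even part v. Neither v nor Ψ need be harmonic
  -- separately.
  have hdec : ∀ z, h z = (d i : ℝ) * v z + lift c Ψ z := by
    intro z
    have : u z = (d i : ℝ) * F (cproj z) + lift c Ψ z := by
      simp only [hu, lift, potential, hΨ]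
      rw [← Finset.add_sum_erase _ _ (Finset.mem_univ i), ← hc, add_sub_cancel_left,
        Finset.filter_ne']
    simp only [hh, hv, this]; ring
  have hps : ∀ z : ℂ, ‖z‖ < r → z ≠ 0 → SmoothAt 2 (potential F a d) (c + cproj z) :=
    fun z hz hz0 => smoothAt_potential hF (hra z hz hz0)
  have hlog : ∀ z : ℂ, z ≠ 0 → HarmonicAt (fun z : ℂ => Real.log ‖z‖) z := fun z hz =>
    AnalyticAt.harmonicAt_log_norm (f := fun z => z) analyticAt_id hz
  have hhh : HarmonicOnNhd h (ball 0 r \ {0}) := by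
    rintro z ⟨hz, hz0⟩
    have hz : ‖z‖ < r := by simpa using hz
    exact (harmonicAt_lift (hps z hz hz0) (eventually_lap_potential hF hd (hra z hz hz0))).sub
      ((hlog z hz0).const_smul (c := (d i : ℝ)))
  have hlim : Tendsto h (𝓝[≠] 0) (𝓝 ((d i : ℝ) * 0 + lift c Ψ 0)) := by
    have h1 : Tendsto (lift c Ψ) (𝓝[≠] 0) (𝓝 (lift c Ψ 0)) :=
      (ContDiffAt.continuousAt hΨs).tendsto.mono_left nhdsWithin_le_nhds
    exact ((hF.tendsto_sub_log.const_mul _).add h1).congr fun z => (hdec z).symm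
  obtain ⟨Q, hQ, hQh⟩ := exists_holomorphic_extension_cgrad hr hhh hlim
  refine ⟨Q, hQ, ?_, ?_⟩
  · intro z hz hz0
    have hz' : ‖z‖ < r := by simpa using hz
    have hud : DifferentiableAt ℝ u z :=
      ((smoothAt_add_cproj z).1 (hps z hz' hz0)).differentiableAt (by simp)
    have hld : DifferentiableAt ℝ (fun z : ℂ => Real.log ‖z‖) z :=
      (hlog z hz0).1.differentiableAt (by simp)
    rw [tgrad_eq_cgrad hud, hQh z hz hz0, ← cgrad_log_norm hz0, cgrad, cgrad, cgrad, hh,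
      fderiv_fun_sub hud (hld.const_mul _), fderiv_const_mul hld]
    simp
    ring
  · have hk : ContinuousAt (cgrad (lift c Ψ)) 0 := by
      have h1 : ContinuousAt (fderiv ℝ (lift c Ψ)) 0 :=
        (ContDiffAt.fderiv_right (m := 1) hΨs (by norm_num)).continuousAt
      have h2 : ∀ w : ℂ, ContinuousAt (fun z => (fderiv ℝ (lift c Ψ) z w : ℂ)) 0 := fun w =>
        Complex.continuous_ofReal.continuousAt.comp (h1.clm_apply continuousAt_const)
      exact (h2 1).sub (continuousAt_const.mul (h2 Complex.I))
    have hQc : ContinuousAt Q 0 :=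
      (hQ.differentiableAt (ball_mem_nhds _ hr)).continuousAt
    have hΨd : ∀ᶠ z in 𝓝 (0 : ℂ), DifferentiableAt ℝ (lift c Ψ) z := by
      filter_upwards [ContDiffAt.eventually hΨs (by simp)] with z hz
      exact hz.differentiableAt (by simp)
    have hQe : ∀ᶠ z in 𝓝[≠] (0 : ℂ), Q z = (d i : ℂ) * cgrad v z + cgrad (lift c Ψ) z := by
      rw [eventually_nhdsWithin_iff]
      filter_upwards [hΨd, ball_mem_nhds (0 : ℂ) hr] with z hz1 hz hz0
      have hz0 : z ≠ 0 := hz0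
      have hz' : ‖z‖ < r := by simpa using hz
      have hvd : DifferentiableAt ℝ v z := by
        have h1 := hF.smoothAt (cproj_ne_zero (hz'.le.trans hr2) hz0)
        have h2 : ContDiffAt ℝ 2 (lift 0 F) z := (smoothAt_add_cproj z).1 (by simpa using h1)
        have h3 : lift 0 F = fun z => F (cproj z) := by ext; simp [lift]
        rw [h3] at h2
        exact (h2.differentiableAt (by simp)).sub ((hlog z hz0).1.differentiableAt (by simp))
      have hfun : h = fun z => (d i : ℝ) * v z + lift c Ψ z := funext hdec
      rw [hQh z hz hz0, hfun, cgrad, cgrad, cgrad, fderiv_fun_add (hvd.const_mul _) hz1,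
        fderiv_const_mul hvd]
      simp
      ring
    have hveven : ∀ z, v (-z) = v z := fun z => by simp [hv, cproj_neg, hF.even]
    have hodd : ∀ z, cgrad v (-z) = -cgrad v z := by
      intro z
      have h1 : fderiv ℝ v z = -fderiv ℝ v (-z) := by
        have := (ContinuousLinearEquiv.neg ℝ (M := ℂ)).comp_right_fderiv (f := v) (x := z)
        have e : v ∘ (ContinuousLinearEquiv.neg ℝ (M := ℂ)) = v := funext hveven
        rw [e] at this
        rw [this]
        ext w
        simp
      rw [cgrad, cgrad, h1]
      simp
      ring
    -- Symmetrizing in z cancels the odd gradient of v exactly, so no limit of that gradient at 0 is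
    -- needed.
    have hlimQ : Tendsto (fun z => Q z + Q (-z)) (𝓝[≠] 0) (𝓝 (Q 0 + Q 0)) :=
      (hQc.tendsto.mono_left nhdsWithin_le_nhds).add
        ((hQc.tendsto.mono_left nhdsWithin_le_nhds).comp tendsto_neg_punctured)
    have hlimk : Tendsto (fun z => cgrad (lift c Ψ) z + cgrad (lift c Ψ) (-z)) (𝓝[≠] 0)
        (𝓝 (cgrad (lift c Ψ) 0 + cgrad (lift c Ψ) 0)) :=
      (hk.tendsto.mono_left nhdsWithin_le_nhds).add
        ((hk.tendsto.mono_left nhdsWithin_le_nhds).comp tendsto_neg_punctured)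
    have heq : (fun z => Q z + Q (-z)) =ᶠ[𝓝[≠] 0]
        fun z => cgrad (lift c Ψ) z + cgrad (lift c Ψ) (-z) := by
      filter_upwards [hQe, tendsto_neg_punctured.eventually hQe] with z h1 h2
      rw [h1, h2, hodd]; ring
    have h2 := tendsto_nhds_unique (hlimQ.congr' heq) hlimk
    have h3 : Q 0 = cgrad (lift c Ψ) 0 := by linear_combination h2 / 2
    have h4 := tgrad_eq_cgrad (x := c) (w := 0) (u := Ψ) (hΨs.differentiableAt (by simp))
    rw [cproj_zero, add_zero] at h4
    rw [h3, ← h4, tgrad, pd_sum_green hF _ hne, pd_sum_green hF _ hne]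
    simp only [tgrad]
    push_cast
    rw [Finset.mul_sum, ← Finset.sum_sub_distrib]
    exact Finset.sum_congr rfl fun j _ => by ring

end Potential

end

/-! ### The Hopf differential identity -/

section

open Metric

/-- The circle has no isolated points, so its Haar measure has no atoms; this passes to the product.
-/
lemma volume_range_eq_zero {m : ℕ} (a : Fin m → T2) : volume (Set.range a) = 0 := by
  have ht : Tendsto ((↑) : ℝ → UnitAddCircle) (𝓝[≠] 0) (𝓝[≠] 0) := by
    refine tendsto_nhdsWithin_iff.2 ⟨?_, ?_⟩
    · exact ((AddCircle.continuous_mk' 1).tendsto 0).mono_left nhdsWithin_le_nhds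
    · filter_upwards [self_mem_nhdsWithin,
        nhdsWithin_le_nhds (ball_mem_nhds (0 : ℝ) (show (0 : ℝ) < 1 / 2 by norm_num))] with t ht hb
      have h := (AddCircle.norm_coe_eq_abs_iff (x := t) 1 one_ne_zero).2
        (by simpa using le_of_lt (mem_ball_zero_iff.1 hb))
      intro h0
      have h0 : (t : UnitAddCircle) = 0 := h0
      rw [h0, norm_zero] at h
      exact ht (abs_eq_zero.1 h.symm)
  have : (𝓝[≠] (0 : UnitAddCircle)).NeBot := ht.neBot
  have h1 : NullSingletonClass (volume : Measure UnitAddCircle) := inferInstance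
  have h2 : NullSingletonClass (volume : Measure T2) := Measure.pi_nullSingletonClass'
  exact (Set.finite_range a).measure_zero _

section Identity

variable {F : T2 → ℝ} {m : ℕ} {a : Fin m → T2} {d : Fin m → ℤ} {η : T2 → ℝ}

lemma eventually_eq_zero_of_tsupport {i j : Fin m} (ha : Function.Injective a)
    (hsupp : tsupport η ∩ Set.range a = {a i}) (hj : j ≠ i) : η =ᶠ[𝓝 (a j)] fun _ => 0 := by
  refine notMem_tsupport_iff_eventuallyEq.1 fun h => hj (ha ?_)
  have : a j ∈ tsupport η ∩ Set.range a := ⟨h, j, rfl⟩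
  rwa [hsupp] at this

/-- The operator `(∂_x + i ∂_y) u` for real `u`. -/
def dbarReal (u : T2 → ℝ) (x : T2) : ℂ := (pd 0 u x : ℝ) + Complex.I * (pd 1 u x : ℝ)

lemma dbar_ofReal {u : T2 → ℝ} {x : T2} (h : SmoothAt 1 u x) :
    dbar (fun y => (u y : ℂ)) x = dbarReal u x := by
  rw [dbar, pd_ofReal h, pd_ofReal h, dbarReal]

lemma smoothAt_dbarReal {u : T2 → ℝ} {x : T2} (h : SmoothAt 2 u x) : SmoothAt 1 (dbarReal u) x :=
  (h.pd (by norm_num) 0).ofReal.add ((smoothAt_const _).mul (h.pd (by norm_num) 1).ofReal)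

lemma dbar_dbarReal {u : T2 → ℝ} {x : T2} (h : SmoothAt 2 u x) :
    dbar (dbarReal u) x = (pd 0 (pd 0 u) x - pd 1 (pd 1 u) x : ℝ) +
      Complex.I * (2 * pd 1 (pd 0 u) x : ℝ) := by
  have h0 : SmoothAt 1 (pd 0 u) x := h.pd (by norm_num) 0
  have h1 : SmoothAt 1 (pd 1 u) x := h.pd (by norm_num) 1
  have e : ∀ k, pd k (dbarReal u) x =
      ((pd k (pd 0 u) x : ℝ) : ℂ) + Complex.I * ((pd k (pd 1 u) x : ℝ) : ℂ) := fun k => by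
    have : dbarReal u = fun y => ((pd 0 u y : ℝ) : ℂ) + Complex.I * ((pd 1 u y : ℝ) : ℂ) := rfl
    rw [this, pd_add h0.ofReal ((smoothAt_const _).mul h1.ofReal), pd_const_mul _ h1.ofReal,
      pd_ofReal h0, pd_ofReal h1]
  rw [dbar, e, e, pd_comm h 1 0]
  push_cast
  linear_combination ((pd 1 (pd 1 u) x : ℝ) : ℂ) * Complex.I_mul_I

/-- Contraction with 𝕁 sees only the trace-free part of the Hessian of η, which is ∂̄²η; f² is the
Hopf differential of Φ. -/
lemma integrand_eq_im {x : T2} (hη : SmoothAt 2 η x) (Φ : T2 → ℝ) :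
    integrand η (fun x => - curl Φ x) x =
      (1 / 2) * (dbar (dbarReal η) x * tgrad Φ x ^ 2).im := by
  rw [dbar_dbarReal hη, tgrad, integrand]
  simp only [Fin.sum_univ_two, J, curl, Pi.neg_apply, Matrix.of_apply, Matrix.cons_val_zero,
    Matrix.cons_val_one, Matrix.cons_val', Matrix.cons_val_fin_one, pd_comm hη 1 0, sq,
    Complex.mul_im, Complex.mul_re, Complex.add_re, Complex.add_im, Complex.sub_re,
    Complex.sub_im, Complex.ofReal_re, Complex.ofReal_im, Complex.I_re, Complex.I_im]
  ring

lemma smoothAt_dbar_mul_tgrad_sq (hF : IsGreen F) {g : T2 → ℂ} (hg : ∀ x, SmoothAt 0 g x)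
    (h0 : ∀ x ∈ Set.range a, g =ᶠ[𝓝 x] fun _ => 0) (x : T2) :
    SmoothAt 0 (fun y => g y * tgrad (potential F a d) y ^ 2) x := by
  have : (fun y => g y * tgrad (potential F a d) y ^ 2) =
      fun y => (tgrad (potential F a d) y * tgrad (potential F a d) y) * g y := by
    ext y; ring
  rw [this]
  refine SmoothAt.mul_of_eventually_eq_zero ?_
  by_cases hx : x ∈ Set.range a
  · exact Or.inr (h0 x hx)
  · have h1 := (smoothAt_potential (d := d) hF hx).tgrad (m := 0) (by norm_num)
    exact Or.inl ⟨h1.mul h1, hg x⟩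

/-- The weighted Hopf differential integrates by parts away from the vortices. -/
lemma integral_dbar_mul_tgrad_sq (hF : IsGreen F) (hd : ∑ j, d j = 0) {g : T2 → ℂ}
    (hg : ∀ x, SmoothAt 1 g x) (h0 : ∀ x ∈ Set.range a, g =ᶠ[𝓝 x] fun _ => 0) :
    ∫ x, dbar g x * tgrad (potential F a d) x ^ 2 = 0 := by
  set f := tgrad (potential F a d) with hf
  have hsm : ∀ x, SmoothAt 1 (fun y => (f y * f y) * g y) x := fun x => by
    refine SmoothAt.mul_of_eventually_eq_zero ?_
    by_cases hx : x ∈ Set.range a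
    · exact Or.inr (h0 x hx)
    · have h1 := (smoothAt_potential (d := d) hF hx).tgrad (m := 1) (by norm_num)
      exact Or.inl ⟨h1.mul h1, hg x⟩
  rw [← integral_dbar_eq_zero hsm]
  refine integral_congr_ae (Eventually.of_forall fun x => ?_)
  by_cases hx : x ∈ Set.range a
  · have h1 : (fun y => (f y * f y) * g y) =ᶠ[𝓝 x] fun _ => 0 := by
      filter_upwards [h0 x hx] with y hy
      rw [hy, mul_zero]
    simp only [dbar_eq_zero (h0 x hx), dbar_eq_zero h1, zero_mul]
  · have h1 := (smoothAt_potential (d := d) hF hx).tgrad (m := 1) (by norm_num)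
    have h2 := dbar_tgrad (smoothAt_potential (d := d) hF hx) (eventually_lap_potential hF hd hx)
    simp only
    rw [dbar_mul (h1.mul h1) (hg x), dbar_mul h1 h1, h2]
    ring

lemma integral_dbar_dbarReal (hF : IsGreen F) (ha : Function.Injective a) (hd : ∑ j, d j = 0)
    (i : Fin m) (hη : ∀ x, SmoothAt 2 η x)
    (hsupp : tsupport η ∩ Set.range a = {a i})
    (hflat : ∀ᶠ x in 𝓝 (a i), ∀ j l, pd l (pd j η) x = 0) :
    Integrable (fun x => dbar (dbarReal η) x * tgrad (potential F a d) x ^ 2) ∧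
    ∫ x, dbar (dbarReal η) x * tgrad (potential F a d) x ^ 2 =
      -(4 * Real.pi * d i * (dbarReal η (a i) *
        ∑ j with j ≠ i, (d j : ℂ) * tgrad F (a i - a j))) := by
  obtain ⟨r, hr, hr2, hra⟩ := exists_isolating_radius ha i
  obtain ⟨Q, hQ, hfQ, hQ0⟩ := exists_simplePole hF hd i hr hr2 ha hra
  set c := a i with hc
  set f := tgrad (potential F a d) with hf
  set P := dbarReal η with hP
  -- The 9 makes 8 < K, for smoothness of the cutoff; the second term gives K r² > 2, which confines
  -- the cutoff to the disc of radius r.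
  set K : ℝ := 9 + 3 / r ^ 2 with hK
  have h3r : 0 < 3 / r ^ 2 := by positivity
  have hK8 : 8 < K := by linarith
  have hKr : 2 < K * r ^ 2 := by
    have : K * r ^ 2 = 9 * r ^ 2 + 3 := by rw [hK]; field_simp
    rw [this]; nlinarith [sq_nonneg r]
  set χ : T2 → ℂ := fun x => (cutoff K c x : ℂ) with hχ
  have hPs : ∀ x, SmoothAt 1 P x := fun x => smoothAt_dbarReal (hη x)
  have hχr : ∀ x, SmoothAt 1 (cutoff K c) x := fun x => smoothAt_cutoff hK8 1 c x
  have hχs : ∀ x, SmoothAt 1 χ x := fun x => (hχr x).ofReal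
  have hχc : χ =ᶠ[𝓝 c] fun _ => 1 := by
    filter_upwards [cutoff_eventually_eq_one K c] with y hy
    simp only [hχ]; rw [hy, Complex.ofReal_one]
  have hχj : ∀ j, j ≠ i → χ =ᶠ[𝓝 (a j)] fun _ => 0 := by
    intro j hj
    have hfar : 2 < K * tnormSq (a j - c) := by
      obtain ⟨z, hz, hz'⟩ := exists_cproj_tnormSq (a j - c)
      have hz0 : z ≠ 0 := by
        rintro rfl
        rw [cproj_zero] at hz
        exact hj (ha (sub_eq_zero.1 hz))
      have hzr : r ≤ ‖z‖ := by
        by_contra! hlt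
        exact hra z hlt hz0 ⟨j, by rw [← hz]; abel⟩
      rw [hz']
      have : r ^ 2 ≤ ‖z‖ ^ 2 := by gcongr
      nlinarith
    filter_upwards [cutoff_eventually_eq_zero hfar] with y hy
    simp only [hχ]; rw [hy, Complex.ofReal_zero]
  have hPc : P =ᶠ[𝓝 c] fun _ => P c := by
    have hk : ∀ k, pd k η =ᶠ[𝓝 c] fun _ => pd k η c := fun k =>
      eventually_const_of_pd_eq_zero (fun x => (hη x).pd (by norm_num) k)
        (hflat.mono fun x hx l => hx k l)
    filter_upwards [hk 0, hk 1] with y h1 h2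
    simp only [hP, dbarReal, h1, h2]
  have hPj : ∀ j, j ≠ i → P =ᶠ[𝓝 (a j)] fun _ => 0 := by
    intro j hj
    have h0 := eventually_eq_zero_of_tsupport ha hsupp hj
    filter_upwards [pd_eventuallyEq 0 h0, pd_eventuallyEq 1 h0] with y h1 h2
    simp [hP, dbarReal, h1, h2]
  have hdP : ∀ x ∈ Set.range a, dbar P =ᶠ[𝓝 x] fun _ => 0 := by
    rintro x ⟨j, rfl⟩
    by_cases hj : j = i
    · rw [hj]; exact dbar_eventuallyEq_zero hPc
    · exact dbar_eventuallyEq_zero (hPj j hj)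
  have hdχ : ∀ x ∈ Set.range a, dbar χ =ᶠ[𝓝 x] fun _ => 0 := by
    rintro x ⟨j, rfl⟩
    by_cases hj : j = i
    · rw [hj]; exact dbar_eventuallyEq_zero hχc
    · exact dbar_eventuallyEq_zero (hχj j hj)
  have cP := continuous_of_smoothAt (smoothAt_dbar_mul_tgrad_sq (a := a) (d := d) hF
    (fun x => (hPs x).dbar (by norm_num)) hdP)
  have cχ := continuous_of_smoothAt (smoothAt_dbar_mul_tgrad_sq (a := a) (d := d) hF
    (fun x => (hχs x).dbar (by norm_num)) hdχ)
  -- P - P(c)χ vanishes near every vortex: at c because P is constant and χ = 1 there, elsewhere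
  -- because both terms vanish.
  have hsplit := integral_dbar_mul_tgrad_sq (a := a) (d := d) hF hd
    (g := fun x => P x + (-P c) * χ x)
    (fun x => (hPs x).add ((smoothAt_const _).mul (hχs x))) (by
      rintro x ⟨j, rfl⟩
      by_cases hj : j = i
      · rw [hj]
        filter_upwards [hPc, hχc] with y h1 h2
        rw [h1, h2]; ring
      · filter_upwards [hPj j hj, hχj j hj] with y h1 h2
        rw [h1, h2]; ring)
  have hdS : ∀ x, dbar (fun x => P x + (-P c) * χ x) x * f x ^ 2 =
      dbar P x * f x ^ 2 + (-P c) * (dbar χ x * f x ^ 2) := by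
    intro x
    simp only [dbar]
    rw [pd_add (hPs x) ((smoothAt_const _).mul (hχs x)), pd_const_mul _ (hχs x),
      pd_add (hPs x) ((smoothAt_const _).mul (hχs x)), pd_const_mul _ (hχs x)]
    ring
  have iP := integrable_of_continuous cP
  have iχ := integrable_of_continuous cχ
  rw [integral_congr_ae (Eventually.of_forall hdS), integral_add iP (iχ.const_mul _),
    integral_const_mul] at hsplit
  have hplane : ∫ x, dbar χ x * f x ^ 2 = -(4 * Real.pi * d i * Q 0) := by
    rw [← integral_cutoff_sq_simplePole (f := lift c f) (d i : ℂ) hr hKr hQ hfQ]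
    refine integral_eq_integral_complex cχ c ?_ ?_ ?_
    · intro z hz
      rw [dbar_ofReal (hχr _), dbarReal, cpd_cutoff hz]
      rfl
    · intro z hz
      rw [deriv_radialProfile_eq_zero (Or.inr (by nlinarith))]
      simp
    · intro x hx
      have : χ =ᶠ[𝓝 x] fun _ => 0 := by
        filter_upwards [cutoff_eventually_eq_zero (K := K) (c := c) (x := x)
          (by nlinarith)] with y hy
        simp only [hχ]; rw [hy, Complex.ofReal_zero]
      rw [dbar_eq_zero this, zero_mul]
  refine ⟨iP, ?_⟩
  rw [hplane, hQ0] at hsplit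
  linear_combination hsplit

lemma integrand_neg_curl (hF : IsGreen F) (ha : Function.Injective a) (hd : ∑ j, d j = 0)
    (i : Fin m) (hη : ∀ x, SmoothAt 2 η x)
    (hsupp : tsupport η ∩ Set.range a = {a i})
    (hflat : ∀ᶠ x in 𝓝 (a i), ∀ j l, pd l (pd j η) x = 0) :
    Integrable (integrand η (fun x => - curl (potential F a d) x)) ∧
      ∫ x, integrand η (fun x => - curl (potential F a d) x) x =
        (d i : ℝ) * (grad η (a i) ⬝ᵥ
          ((2 * Real.pi) • ∑ j with j ≠ i, (d j : ℝ) • curl F (a i - a j))) := by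
  obtain ⟨hi, he⟩ := integral_dbar_dbarReal hF ha hd i hη hsupp hflat
  have hfun : integrand η (fun x => - curl (potential F a d) x) =
      fun x => (1 / 2) * (dbar (dbarReal η) x * tgrad (potential F a d) x ^ 2).im :=
    funext fun x => integrand_eq_im (hη x) _
  rw [hfun]
  refine ⟨hi.im.const_mul _, ?_⟩
  have him := Complex.imCLM.integral_comp_comm hi
  simp only [Complex.imCLM_apply] at him
  have hsum : ∑ j with j ≠ i, (d j : ℂ) * tgrad F (a i - a j) =
      ((∑ j with j ≠ i, (d j : ℝ) * pd 0 F (a i - a j) : ℝ) : ℂ) -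
        Complex.I * ((∑ j with j ≠ i, (d j : ℝ) * pd 1 F (a i - a j) : ℝ) : ℂ) := by
    push_cast
    rw [Finset.mul_sum, ← Finset.sum_sub_distrib]
    exact Finset.sum_congr rfl fun j _ => by rw [tgrad]; ring
  have hcurl : ∑ j with j ≠ i, (d j : ℝ) • curl F (a i - a j) =
      ![∑ j with j ≠ i, (d j : ℝ) * pd 1 F (a i - a j),
        -∑ j with j ≠ i, (d j : ℝ) * pd 0 F (a i - a j)] := by
    ext k
    fin_cases k <;> simp [curl, Finset.sum_apply]
  rw [integral_const_mul, him, he, hsum, hcurl, dbarReal]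
  set A := ∑ j with j ≠ i, (d j : ℝ) * pd 0 F (a i - a j)
  set B := ∑ j with j ≠ i, (d j : ℝ) * pd 1 F (a i - a j)
  have hd' : (4 * (Real.pi : ℂ) * (d i : ℂ)) = ((4 * Real.pi * (d i : ℝ) : ℝ) : ℂ) := by
    push_cast; ring
  rw [hd', Complex.neg_im, Complex.im_ofReal_mul]
  simp [grad, Matrix.vecHead, Matrix.vecTail]
  ring

end Identity

end

end TorusVortex

end


open TorusVortex

theorem lemma1 {m : ℕ} (a : Fin m → T2) (ha : Function.Injective a)
    (d : Fin m → ℤ) (hd : ∑ j, d j = 0)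
    (F : T2 → ℝ) (hF : IsGreen F)
    (i : Fin m) (η : T2 → ℝ) (hη : TorusContDiff 2 η)
    (hsupp : tsupport η ∩ Set.range a = {a i})
    (hflat : ∀ᶠ x in 𝓝 (a i), ∀ j l, pd l (pd j η) x = 0) :
    (∀ H : T2 → ℂ, IsCanonicalHarmonicMap F a d H →
      Integrable (integrand η (current H)) ∧
      ∫ x, integrand η (current H) x =
        (d i : ℝ) * (grad η (a i) ⬝ᵥ
          ((2 * Real.pi) • ∑ j with j ≠ i, (d j : ℝ) • curl F (a i - a j)))) ∧
    (Integrable (integrand η (fun x => - curl (potential F a d) x)) ∧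
      ∫ x, integrand η (fun x => - curl (potential F a d) x) x =
        (d i : ℝ) * (grad η (a i) ⬝ᵥ
          ((2 * Real.pi) • ∑ j with j ≠ i, (d j : ℝ) • curl F (a i - a j)))) := by
  have key := integrand_neg_curl hF ha hd i hη.smoothAt hsupp hflat
  refine ⟨fun H hH => ?_, key⟩
  -- The integrand depends on H only through its current, prescribed off the finite set of vortices.
  have hae : integrand η (current H) =ᵐ[volume]
      integrand η (fun x => - curl (potential F a d) x) := by
    have hnull : volume (Set.range a) = 0 := volume_range_eq_zero a
    filter_upwards [compl_mem_ae_iff.2 hnull] with x hx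
    simp only [integrand, hH.current_eq x hx, Pi.neg_apply]
  exact ⟨key.1.congr hae.symm, (integral_congr_ae hae).trans key.2⟩
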